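/- Let $W:\{0,1\}\to\mathcal Y$ be a binary-input discrete memoryless channel with finite output alphabet $\mathcal Y$ and transition probabilities $W(y\mid x)$. Let $I(W)$ be its symmetric mutual information, i.e. the mutual information in bits between input and output of $W$ for the uniform input distribution, and let $Z(W)=\sum_{y\in\mathcal Y}\sqrt{W(y\mid 0)W(y\mid 1)}$ be its Bhattacharyya parameter. For a channel $V$ define the channels $$V^{[0]}(y_0,y_1\mid u_0)=\tfrac12\sum_{u_1\in\{0,1\}}V(y_0\mid u_0\oplus u_1)V(y_1\mid u_1),\qquad V^{[1]}(y_0,y_1,u_0\mid u_1)=\tfrac12 V(y_0\mid u_0\oplus u_1)V(y_1\mid u_1).$$ Let $B_1,B_2,\dots$ be i.i.d. random bits with $\Pr(B_n=0)=\Pr(B_n=1)=\tfrac12$, and put $W_0=W$, $W_{n+1}=W_n^{[B_{n+1}]}$, $Z_n=Z(W_n)$. Then for every real $\beta<\tfrac12$, $$\lim_{n\to\infty}\Pr\bigl(Z_n\ge 1-2^{-2^{n\beta}}\bigr)=1-I(W).$$ Moreover (equivalently), let $N=2^n$ and let $H_n=A_nG_2^{\otimes n}$ over $GF(2)$, where $G_2=\begin{pmatrix}1&0\\1&1\end{pmatrix}$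 and $A_n$ is the bit-reversal permutation matrix on the indices $0,\dots,N-1$. For $0\le i\le N-1$ let $W^{(i)}$ be the synthetic channel with input $u_i$, output $(y_0^{N-1},u_0^{i-1})\in\mathcal Y^N\times\{0,1\}^i$ and transition probabilities $$W^{(i)}(y_0^{N-1},u_0^{i-1}\mid u_i)=\frac1{2^{N-1}}\sum_{u_{i+1}^{N-1}\in\{0,1\}^{N-1-i}}\ \prod_{j=0}^{N-1}W\bigl(y_j\mid (\bar uH_n)_j\bigr),\qquad \bar u=(u_0,\dots,u_{N-1}),$$ and let $Z^{(i)}=Z(W^{(i)})$. Then for every real $\beta<\tfrac12$, $$\lim_{n\to\infty}\frac{\bigl|\{i\in\{0,\dots,2^n-1\}:Z^{(i)}\ge 1-2^{-2^{n\beta}}\}\bigr|}{2^n}=1-I(W).$$ -/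

import Mathlib

open MeasureTheory ProbabilityTheory Filter Topology
open scoped Kronecker

universe u v

/-- A binary-input discrete memoryless channel: a finite output alphabet `Out` and transition
probabilities `W(y ∣ x) = prob x y`. The input alphabet `{0,1}` is `ZMod 2`, so that `⊕` is `+`. -/
structure BDMC where
  Out : Type u
  [fintypeOut : Fintype Out]
  prob : ZMod 2 → Out → ℝ
  prob_nonneg : ∀ x y, 0 ≤ prob x y
  prob_sum : ∀ x, ∑ y, prob x y = 1

attribute [instance] BDMC.fintypeOut

namespace BDMC

/-- The Bhattacharyya parameter `Z(W) = ∑ y, √(W(y∣0) W(y∣1))`. -/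
noncomputable def bhattacharyya (W : BDMC.{u}) : ℝ :=
  ∑ y, Real.sqrt (W.prob 0 y * W.prob 1 y)

/-- The probability of the output `y` under the uniform input distribution. -/
noncomputable def outProb (W : BDMC.{u}) (y : W.Out) : ℝ :=
  ∑ x : ZMod 2, (1 / 2) * W.prob x y

/-- The symmetric mutual information `I(W)`, in bits: the mutual information between input and
output for the uniform input distribution. (`0 * log 0 = 0`, and `W.outProb y = 0` only
if `W(y∣0) = W(y∣1) = 0`.) -/
noncomputable def symmInfo (W : BDMC.{u}) : ℝ :=
  ∑ x : ZMod 2, ∑ y, (1 / 2) * W.prob x y * Real.logb 2 (W.prob x y / W.outProb y)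

/-- The channel `W^[0](y₀, y₁ ∣ u₀) = ½ ∑_{u₁} W(y₀ ∣ u₀ ⊕ u₁) W(y₁ ∣ u₁)`. -/
noncomputable def minus (W : BDMC.{u}) : BDMC.{u} where
  Out := W.Out × W.Out
  prob u₀ y := (1 / 2) * ∑ u₁ : ZMod 2, W.prob (u₀ + u₁) y.1 * W.prob u₁ y.2
  prob_nonneg u₀ y := mul_nonneg (by norm_num)
    (Finset.sum_nonneg fun _ _ => mul_nonneg (W.prob_nonneg _ _) (W.prob_nonneg _ _))
  prob_sum u₀ := by
    rw [← Finset.mul_sum, Finset.sum_comm]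
    simp [Fintype.sum_prod_type, ← Finset.mul_sum, W.prob_sum, ZMod.card]

/-- The channel `W^[1](y₀, y₁, u₀ ∣ u₁) = ½ W(y₀ ∣ u₀ ⊕ u₁) W(y₁ ∣ u₁)`. -/
noncomputable def plus (W : BDMC.{u}) : BDMC.{u} where
  Out := W.Out × W.Out × ZMod 2
  prob u₁ y := (1 / 2) * (W.prob (y.2.2 + u₁) y.1 * W.prob u₁ y.2.1)
  prob_nonneg u₁ y :=
    mul_nonneg (by norm_num) (mul_nonneg (W.prob_nonneg _ _) (W.prob_nonneg _ _))
  prob_sum u₁ := by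
    have h : ∀ y₀ : W.Out, ∀ v : ZMod 2,
        ∑ y₁, (1 / 2 : ℝ) * (W.prob (v + u₁) y₀ * W.prob u₁ y₁)
          = (1 / 2) * W.prob (v + u₁) y₀ := by
      intro y₀ v
      rw [← Finset.mul_sum, ← Finset.mul_sum, W.prob_sum, mul_one]
    simp only [Fintype.sum_prod_type]
    have h2 : ∀ y₀ : W.Out,
        ∑ y₁, ∑ v : ZMod 2, (1 / 2 : ℝ) * (W.prob (v + u₁) y₀ * W.prob u₁ y₁)
          = ∑ v : ZMod 2, (1 / 2) * W.prob (v + u₁) y₀ := by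
      intro y₀
      rw [Finset.sum_comm]
      exact Finset.sum_congr rfl fun v _ => h y₀ v
    rw [Finset.sum_congr rfl fun y₀ _ => h2 y₀, Finset.sum_comm]
    simp [← Finset.mul_sum, W.prob_sum, ZMod.card]

/-- `W^[b]` for a bit `b`. -/
noncomputable def split (W : BDMC.{u}) (b : Fin 2) : BDMC.{u} :=
  if b = 0 then W.minus else W.plus

/-- The channel reached from `W` along the bits `b 0, b 1, …, b (n - 1)`:
`W_0 = W` and `W_{n+1} = W_n^[b n]`. -/
noncomputable def tree (W : BDMC.{u}) (b : ℕ → Fin 2) : ℕ → BDMC.{u}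
  | 0 => W
  | n + 1 => (W.tree b n).split (b n)

end BDMC

/-- The kernel matrix `G₂` over `GF(2)`. -/
def polarKernel : Matrix (Fin 2) (Fin 2) (ZMod 2) := !![1, 0; 1, 1]

/-- The `n`-th Kronecker power of `G₂`, with rows and columns indexed by `0, …, 2 ^ n - 1`
in the usual order. -/
def polarKroneckerPow : (n : ℕ) → Matrix (Fin (2 ^ n)) (Fin (2 ^ n)) (ZMod 2)
  | 0 => 1
  | n + 1 =>
    let e : Fin 2 × Fin (2 ^ n) ≃ Fin (2 ^ (n + 1)) :=
      finProdFinEquiv.trans (finCongr (pow_succ' 2 n).symm)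
    Matrix.reindex e e (polarKernel ⊗ₖ polarKroneckerPow n)

/-- The bit-reversal permutation of `{0, …, 2 ^ n - 1}`: write an index with `n` binary digits
and reverse their order. -/
def bitReversal (n : ℕ) : Equiv.Perm (Fin (2 ^ n)) :=
  finFunctionFinEquiv.symm.trans
    ((Fin.revPerm.arrowCongr (Equiv.refl (Fin 2))).trans finFunctionFinEquiv)

/-- The polar transform `H_n = A_n G₂^{⊗ n}`, where `A_n` is the bit-reversal permutation. -/
def polarTransform (n : ℕ) : Matrix (Fin (2 ^ n)) (Fin (2 ^ n)) (ZMod 2) :=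
  (bitReversal n).permMatrix (ZMod 2) * polarKroneckerPow n

namespace BDMC

/-- `P(y ∣ u) = ∏ j, W(y_j ∣ (u H_n)_j)`: the probability of receiving `y` when `u H_n` is sent
over `2 ^ n` independent copies of `W`. -/
noncomputable def blockProb (W : BDMC.{u}) (n : ℕ) (u : Fin (2 ^ n) → ZMod 2)
    (y : Fin (2 ^ n) → W.Out) : ℝ :=
  ∏ j, W.prob (Matrix.vecMul u (polarTransform n) j) (y j)

/-- The synthetic channel `W^(i)` at block length `N = 2 ^ n`, `0 ≤ i < N`, with input `u_i` and
output `(y, (u_0, …, u_{i-1}))`. Its transition probability is `2^{-(N-1)}` times the sum of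
`P(y ∣ u)` over all completions `u` of `u_0, …, u_i`, that is, over `u_{i+1}, …, u_{N-1}`. -/
noncomputable def synth (W : BDMC.{u}) (n : ℕ) (i : Fin (2 ^ n)) : BDMC.{u} where
  Out := (Fin (2 ^ n) → W.Out) × (Fin (i : ℕ) → ZMod 2)
  prob x o := (1 / 2 ^ (2 ^ n - 1)) *
    ∑ u : Fin (2 ^ n) → ZMod 2 with
      u i = x ∧ ∀ j : Fin (i : ℕ), u (Fin.castLE i.isLt.le j) = o.2 j, W.blockProb n u o.1
  prob_nonneg x o := mul_nonneg (by positivity)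
    (Finset.sum_nonneg fun _ _ => Finset.prod_nonneg fun _ _ => W.prob_nonneg _ _)
  prob_sum x := by
    have hblock : ∀ u : Fin (2 ^ n) → ZMod 2, ∑ y, W.blockProb n u y = 1 := by
      intro u
      unfold blockProb
      rw [← Fintype.prod_sum (fun j y => W.prob (Matrix.vecMul u (polarTransform n) j) y)]
      simp [W.prob_sum]
    have hcard : (Finset.univ.filter fun u : Fin (2 ^ n) → ZMod 2 => u i = x).card
        = 2 ^ (2 ^ n - 1) := by
      have h1 : (Finset.univ.filter fun u : Fin (2 ^ n) → ZMod 2 => u i = x)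
          = Fintype.piFinset (fun j => if j = i then {x} else Finset.univ) := by
        ext u
        simp only [Finset.mem_filter, Finset.mem_univ, true_and, Fintype.mem_piFinset]
        constructor
        · intro h j
          by_cases hj : j = i
          · subst hj; simp [h]
          · simp [hj]
        · intro h
          simpa using h i
      have h2 : ∀ j : Fin (2 ^ n),
          (if j = i then ({x} : Finset (ZMod 2)) else Finset.univ).card
            = if j = i then 1 else 2 := by
        intro j
        split_ifs <;> simp [ZMod.card]
      rw [h1, Fintype.card_piFinset, Finset.prod_congr rfl fun j _ => h2 j,
        Finset.prod_ite]
      simp [Finset.filter_ne', Finset.card_erase_of_mem]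
    rw [← Finset.mul_sum, Fintype.sum_prod_type]
    have hswap : ∀ y : Fin (2 ^ n) → W.Out,
        ∑ p : Fin (i : ℕ) → ZMod 2, ∑ u : Fin (2 ^ n) → ZMod 2 with
          u i = x ∧ ∀ j : Fin (i : ℕ), u (Fin.castLE i.isLt.le j) = p j, W.blockProb n u y
        = ∑ u : Fin (2 ^ n) → ZMod 2 with u i = x, W.blockProb n u y := by
      intro y
      simp only [Finset.sum_filter]
      rw [Finset.sum_comm]
      refine Finset.sum_congr rfl fun u _ => ?_
      rw [Finset.sum_eq_single (fun j : Fin (i : ℕ) => u (Fin.castLE i.isLt.le j))]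
      · simp
      · intro p _ hp
        rw [if_neg]
        rintro ⟨-, h⟩
        exact hp (funext fun j => (h j).symm)
      · simp
    simp only [hswap]
    rw [Finset.sum_comm, Finset.sum_congr rfl fun u _ => hblock u]
    simp [hcard]

end BDMC

/-! Alongside the Bhattacharyya parameter Z, follow the total variation distance T between the two
output laws. The two behave dually under splitting: the plus split squares Z and the minus split
squares T, while the other split sends Z to at most 2Z - Z² and T to at most 2T - T². They are tied
together by T² + Z² ≤ 1 and 1 - Z ≤ T.

Polarization. These relations make √(T Z) shrink on average by the factor √(15/16) < 1 at each
split, so by Markov's inequality T or Z is exponentially small with probability close to 1. The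
information I is preserved on average, takes values in [0, 1], and satisfies I ≤ C T and 1 - I ≤ C'
Z. Hence Z is small with probability at least about I(W), and T is small with probability at least
about 1 - I(W) (`le_pathProb_of_contraction`).

Rate. A quantity that is squared by one split and at most doubled by the other has its exponent
-log₂ doubled about half of the time and otherwise lowered by at most 1. A Chernoff bound on the
number of squarings (`pathProb_tail_le`) turns exponential smallness into 2^(-2^(nβ)) for every β <
1/2 (`eventually_le_pathProb`).

Conclusion. Small T forces Z ≥ 1 - T close to 1, which gives the lower bound 1 - I(W). Small Z
excludes Z near 1, which gives the matching upper bound.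

Both formulations reduce to the same average over paths, `pathProb`. For random bits, each path of
length n has probability 2^(-n). For synthetic channels, the recursion of the polar transform
identifies the channels of indices 2i and 2i + 1 with the minus and plus splits of channel i, up to
relabelling outputs. -/

namespace BDMC

/-! ### Averages over random splitting paths -/

/-- The mean of `f` over the two channels `W^[0]` and `W^[1]`. -/
noncomputable def splitMean (f : BDMC.{u} → ℝ) (W : BDMC.{u}) : ℝ :=
  (f W.minus + f W.plus) / 2

/-- The mean of `f` over the `2 ^ n` channels reached from `W` by `n` splits. -/
noncomputable def pathMean (n : ℕ) (f : BDMC.{u} → ℝ) : BDMC.{u} → ℝ :=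
  splitMean^[n] f

/-- The probability that a channel reached from `W` by `n` uniformly random splits lies in `S`. -/
noncomputable def pathProb (n : ℕ) (S : Set BDMC.{u}) : BDMC.{u} → ℝ :=
  pathMean n (S.indicator 1)

@[simp] theorem pathMean_zero (f : BDMC.{u} → ℝ) : pathMean 0 f = f := rfl

/-- This form peels off the last split of a path, while `pathMean_succ'` peels off the first.
Contraction and the synthetic channels use the former, induction on the starting channel the latter.
-/
theorem pathMean_succ (n : ℕ) (f : BDMC.{u} → ℝ) :
    pathMean (n + 1) f = pathMean n (splitMean f) := rfl

theorem pathMean_succ' (n : ℕ) (f : BDMC.{u} → ℝ) (W : BDMC.{u}) :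
    pathMean (n + 1) f W = (pathMean n f W.minus + pathMean n f W.plus) / 2 := by
  rw [pathMean, Function.iterate_succ_apply']; rfl

theorem pathMean_add_steps (m n : ℕ) (f : BDMC.{u} → ℝ) :
    pathMean (m + n) f = pathMean m (pathMean n f) :=
  Function.iterate_add_apply splitMean m n f

theorem pathMean_mono (n : ℕ) {f g : BDMC.{u} → ℝ} (h : ∀ V, f V ≤ g V) (W : BDMC.{u}) :
    pathMean n f W ≤ pathMean n g W := by
  induction n generalizing W with
  | zero => exact h W
  | succ n ih =>
    rw [pathMean_succ', pathMean_succ']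
    linarith [ih W.minus, ih W.plus]

theorem pathMean_add (n : ℕ) (f g : BDMC.{u} → ℝ) (W : BDMC.{u}) :
    pathMean n (fun V => f V + g V) W = pathMean n f W + pathMean n g W := by
  induction n generalizing W with
  | zero => rfl
  | succ n ih => simp only [pathMean_succ', ih]; ring

theorem pathMean_const_mul (n : ℕ) (c : ℝ) (f : BDMC.{u} → ℝ) (W : BDMC.{u}) :
    pathMean n (fun V => c * f V) W = c * pathMean n f W := by
  induction n generalizing W with
  | zero => rfl
  | succ n ih => simp only [pathMean_succ', ih]; ring

theorem pathMean_const (n : ℕ) (c : ℝ) (W : BDMC.{u}) : pathMean n (fun _ => c) W = c := by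
  induction n generalizing W with
  | zero => rfl
  | succ n ih => simp only [pathMean_succ', ih]; ring

theorem pathMean_eq_self (n : ℕ) {f : BDMC.{u} → ℝ} (h : ∀ V, splitMean f V = f V) :
    pathMean n f = f := by
  induction n with
  | zero => rfl
  | succ n ih => rw [pathMean_succ, funext h, ih]

theorem pathMean_le_pow_mul (n : ℕ) {f : BDMC.{u} → ℝ} {ρ : ℝ} (hρ : 0 ≤ ρ)
    (h : ∀ V, splitMean f V ≤ ρ * f V) (W : BDMC.{u}) : pathMean n f W ≤ ρ ^ n * f W := by
  induction n with
  | zero => simp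
  | succ n ih =>
    calc pathMean (n + 1) f W ≤ pathMean n (fun V => ρ * f V) W := pathMean_mono n h W
      _ = ρ * pathMean n f W := pathMean_const_mul n ρ f W
      _ ≤ ρ * (ρ ^ n * f W) := mul_le_mul_of_nonneg_left ih hρ
      _ = ρ ^ (n + 1) * f W := by ring

theorem pathProb_mono (n : ℕ) {S S' : Set BDMC.{u}} (h : S ⊆ S') (W : BDMC.{u}) :
    pathProb n S W ≤ pathProb n S' W :=
  pathMean_mono n (fun V => Set.indicator_le_indicator_of_subset h (fun _ => zero_le_one) V) W

theorem pathProb_le_one (n : ℕ) (S : Set BDMC.{u}) (W : BDMC.{u}) : pathProb n S W ≤ 1 := by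
  calc pathProb n S W ≤ pathMean n (fun _ => 1) W :=
        pathMean_mono n (fun V => Set.indicator_le_self' (fun _ _ => zero_le_one) V) W
    _ = 1 := pathMean_const n 1 W

theorem pathProb_compl (n : ℕ) (S : Set BDMC.{u}) (W : BDMC.{u}) :
    pathProb n Sᶜ W = 1 - pathProb n S W := by
  have h := pathMean_add n (S.indicator 1) (Sᶜ.indicator 1) W
  have h2 : (fun V => S.indicator (1 : BDMC.{u} → ℝ) V + Sᶜ.indicator 1 V) = fun _ => 1 := by
    ext V
    exact congrFun (Set.indicator_self_add_compl S (1 : BDMC.{u} → ℝ)) V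
  rw [h2, pathMean_const] at h
  unfold pathProb
  linarith

/-- Conditioning on the channel reached after `m` splits. -/
theorem pathProb_add_steps_le (m n : ℕ) {S G : Set BDMC.{u}} {ε : ℝ} (hε : 0 ≤ ε)
    (h : ∀ V ∉ G, pathProb n S V ≤ ε) (W : BDMC.{u}) :
    pathProb (m + n) S W ≤ pathProb m G W + ε := by
  have key : ∀ V, pathProb n S V ≤ G.indicator 1 V + ε := by
    intro V
    by_cases hV : V ∈ G
    · rw [Set.indicator_of_mem hV]
      exact (pathProb_le_one n S V).trans (by simpa using hε)
    · rw [Set.indicator_of_notMem hV, zero_add]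
      exact h V hV
  calc pathProb (m + n) S W = pathMean m (pathProb n S) W := by
        rw [pathProb, pathMean_add_steps]; rfl
    _ ≤ pathMean m (fun V => G.indicator 1 V + ε) W := pathMean_mono m key W
    _ = pathProb m G W + ε := by rw [pathMean_add, pathMean_const]; rfl

/-! ### Chernoff bounds for quantities that are squared or doubled -/

/-- One of the two splits squares `X`, and the other one at most doubles it. -/
def SquaresOrDoubles (X : BDMC.{u} → ℝ) : Prop :=
  ∀ W, (X W.minus ≤ X W ^ 2 ∧ X W.plus ≤ 2 * X W) ∨ (X W.plus ≤ X W ^ 2 ∧ X W.minus ≤ 2 * X W)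

/-- Write X = 2^(-L). A doubling lowers L by at most 1 and a squaring doubles it, so the worst order
puts all doublings first: D squarings in k steps leave an exponent of at least (L - k) 2^D. The
right side is the Chernoff bound E[t^D] t^(-d) for D < d, with D binomial of parameters k and 1/2.
The induction needs no independence, so which split squares may depend on the channel. -/
theorem pathProb_tail_le {X : BDMC.{u} → ℝ} (hX0 : ∀ W, 0 ≤ X W) (hX : SquaresOrDoubles X)
    {t : ℝ} (ht : 0 < t) (ht1 : t ≤ 1) (k : ℕ) (L d : ℝ) (W : BDMC.{u}) (hL : k ≤ L)
    (hW : X W ≤ 2 ^ (-L)) :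
    pathProb k {V | (2 : ℝ) ^ (-((L - k) * 2 ^ d)) < X V} W ≤ ((1 + t) / 2) ^ k * t ^ (-d) := by
  induction k generalizing L d W with
  | zero =>
    simp only [Nat.cast_zero, sub_zero, pow_zero, one_mul] at hL ⊢
    -- With no steps left, the event is empty if d ≤ 0, and the bound is at least 1 if d > 0.
    rcases le_or_gt d 0 with hd | hd
    · have : W ∉ {V | (2 : ℝ) ^ (-(L * 2 ^ d)) < X V} := by
        simp only [Set.mem_ofPred_eq, not_lt]
        refine hW.trans (Real.rpow_le_rpow_of_exponent_le one_le_two ?_)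
        have : (2 : ℝ) ^ d ≤ 1 := Real.rpow_le_one_of_one_le_of_nonpos one_le_two hd
        nlinarith
      rw [pathProb, pathMean_zero, Set.indicator_of_notMem this]
      positivity
    · refine (pathProb_le_one _ _ _).trans ?_
      exact Real.one_le_rpow_of_pos_of_le_one_of_nonpos ht ht1 (by linarith)
  | succ k ih =>
    push_cast at hL ⊢
    have hsq : ∀ V, X V ≤ X W ^ 2 →
        pathProb k {V | (2 : ℝ) ^ (-((L - (k + 1)) * 2 ^ d)) < X V} V
          ≤ ((1 + t) / 2) ^ k * (t ^ (-d) * t) := by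
      intro V hV
      -- Squaring allows the exponent 2L. The weaker 2L - k - 2 is chosen because, after k further
      -- losses, it equals 2 (L - (k + 1)), which reproduces the target threshold with d lowered by
      -- 1.
      have h := ih (2 * L - k - 2) (d - 1) V (by linarith) (hV.trans ?_)
      · have e1 : (2 * L - k - 2 - k) * (2 : ℝ) ^ (d - 1) = (L - (k + 1)) * 2 ^ d := by
          rw [Real.rpow_sub_one two_ne_zero]; ring
        have e2 : t ^ (-(d - 1)) = t ^ (-d) * t := by
          rw [neg_sub, sub_eq_neg_add, Real.rpow_add_one ht.ne']
        rwa [e1, e2] at h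
      · calc X W ^ 2 ≤ ((2 : ℝ) ^ (-L)) ^ 2 := pow_le_pow_left₀ (hX0 W) hW 2
          _ = 2 ^ (-L * 2) := by
            rw [← Real.rpow_natCast, ← Real.rpow_mul zero_le_two]; norm_num
          _ ≤ _ := Real.rpow_le_rpow_of_exponent_le one_le_two (by
            have : (0 : ℝ) ≤ k := k.cast_nonneg
            linarith)
    have hdb : ∀ V, X V ≤ 2 * X W →
        pathProb k {V | (2 : ℝ) ^ (-((L - (k + 1)) * 2 ^ d)) < X V} V
          ≤ ((1 + t) / 2) ^ k * t ^ (-d) := by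
      intro V hV
      have h := ih (L - 1) d V (by linarith) (hV.trans ?_)
      · have e1 : L - 1 - (k : ℝ) = L - (k + 1) := by ring
        rwa [e1] at h
      · calc 2 * X W ≤ 2 * (2 : ℝ) ^ (-L) := by linarith
          _ = 2 ^ (-(L - 1)) := by
            rw [neg_sub, sub_eq_neg_add, Real.rpow_add_one two_ne_zero]; ring
    have e : ((1 + t) / 2) ^ (k + 1) * t ^ (-d)
        = (((1 + t) / 2) ^ k * (t ^ (-d) * t) + ((1 + t) / 2) ^ k * t ^ (-d)) / 2 := by ring
    rw [e, pathProb, pathMean_succ']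
    rcases hX W with ⟨h1, h2⟩ | ⟨h1, h2⟩
    · have a := hsq _ h1
      have b := hdb _ h2
      unfold pathProb at a b
      linarith
    · have a := hsq _ h1
      have b := hdb _ h2
      unfold pathProb at a b
      linarith

/-- Hoeffding's bound for at most α k squarings: with δ = 1/2 - α the Chernoff parameter is t =
exp(-4δ), and cosh x ≤ exp(x²/2) at x = 2δ leaves exp(-2δ²) per step. -/
theorem pathProb_tail_le_exp {X : BDMC.{u} → ℝ} (hX0 : ∀ W, 0 ≤ X W) (hX : SquaresOrDoubles X)
    {α : ℝ} (hα : α ≤ 1 / 2) (k : ℕ) (L : ℝ) (W : BDMC.{u}) (hL : k ≤ L)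
    (hW : X W ≤ 2 ^ (-L)) :
    pathProb k {V | (2 : ℝ) ^ (-((L - k) * 2 ^ (α * k))) < X V} W
      ≤ Real.exp (-2 * (1 / 2 - α) ^ 2) ^ k := by
  set δ : ℝ := 1 / 2 - α with hδ
  have hδ0 : 0 ≤ δ := by linarith
  refine (pathProb_tail_le hX0 hX (t := Real.exp (-4 * δ)) (Real.exp_pos _)
    (Real.exp_le_one_iff.2 (by linarith)) k L (α * k) W hL hW).trans ?_
  have h1 : (1 + Real.exp (-4 * δ)) / 2 ≤ Real.exp (2 * δ ^ 2 - 2 * δ) := by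
    have h := Real.cosh_le_exp_half_sq (2 * δ)
    have e : (1 + Real.exp (-4 * δ)) / 2 = Real.exp (-2 * δ) * Real.cosh (2 * δ) := by
      rw [Real.cosh_eq, mul_div_assoc', mul_add, ← Real.exp_add, ← Real.exp_add]
      ring_nf
      rw [Real.exp_zero]
      ring
    rw [e]
    calc _ ≤ Real.exp (-2 * δ) * Real.exp ((2 * δ) ^ 2 / 2) :=
          mul_le_mul_of_nonneg_left h (Real.exp_pos _).le
      _ = _ := by rw [← Real.exp_add]; ring_nf
  calc ((1 + Real.exp (-4 * δ)) / 2) ^ k * Real.exp (-4 * δ) ^ (-(α * k))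
      ≤ Real.exp (2 * δ ^ 2 - 2 * δ) ^ k * Real.exp (-4 * δ) ^ (-(α * k)) := by
        gcongr
    _ = Real.exp (-2 * δ ^ 2) ^ k := by
        rw [← Real.exp_nat_mul, ← Real.exp_nat_mul, ← Real.exp_mul, ← Real.exp_add]
        congr 1
        have : α = 1 / 2 - δ := by rw [hδ]; ring
        rw [this]; ring

/-! ### Total variation and Bhattacharyya parameter under one split -/

/-- The total variation distance between the output distributions of `W` for the two inputs. -/
noncomputable def tvDist (W : BDMC.{u}) : ℝ :=
  ∑ y, |W.prob 0 y - W.prob 1 y| / 2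

theorem sum_zmod_two (f : ZMod 2 → ℝ) : ∑ x, f x = f 0 + f 1 := Fin.sum_univ_two f

theorem prob_minus_zero (W : BDMC.{u}) (y : W.Out × W.Out) :
    W.minus.prob 0 y = (W.prob 0 y.1 * W.prob 0 y.2 + W.prob 1 y.1 * W.prob 1 y.2) / 2 := by
  simp only [minus, sum_zmod_two, zero_add]; ring

theorem prob_minus_one (W : BDMC.{u}) (y : W.Out × W.Out) :
    W.minus.prob 1 y = (W.prob 1 y.1 * W.prob 0 y.2 + W.prob 0 y.1 * W.prob 1 y.2) / 2 := by
  have : (1 : ZMod 2) + 1 = 0 := rfl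
  simp only [minus, sum_zmod_two, add_zero, this]; ring

/-- T, Z and I are all sums over outputs of a function g of the two likelihoods, so this formula and
`sum_minus` serve for all three. -/
theorem sum_plus (W : BDMC.{u}) (g : ℝ → ℝ → ℝ) :
    ∑ y, g (W.plus.prob 0 y) (W.plus.prob 1 y) = ∑ y : W.Out × W.Out,
      (g (W.prob 0 y.1 * W.prob 0 y.2 / 2) (W.prob 1 y.1 * W.prob 1 y.2 / 2)
        + g (W.prob 1 y.1 * W.prob 0 y.2 / 2) (W.prob 0 y.1 * W.prob 1 y.2 / 2)) := by
  have h11 : (1 : ZMod 2) + 1 = 0 := rfl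
  have : ∑ y, g (W.plus.prob 0 y) (W.plus.prob 1 y)
      = ∑ y : W.Out × W.Out × ZMod 2, g (W.plus.prob 0 y) (W.plus.prob 1 y) := rfl
  rw [this]
  simp only [Fintype.sum_prod_type, sum_zmod_two, plus, zero_add, add_zero, h11]
  refine Finset.sum_congr rfl fun y _ => Finset.sum_congr rfl fun z _ => ?_
  congr 2 <;> ring

theorem sum_minus (W : BDMC.{u}) (g : ℝ → ℝ → ℝ) :
    ∑ y, g (W.minus.prob 0 y) (W.minus.prob 1 y) = ∑ y : W.Out × W.Out,
      g ((W.prob 0 y.1 * W.prob 0 y.2 + W.prob 1 y.1 * W.prob 1 y.2) / 2)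
        ((W.prob 1 y.1 * W.prob 0 y.2 + W.prob 0 y.1 * W.prob 1 y.2) / 2) := by
  have : ∑ y, g (W.minus.prob 0 y) (W.minus.prob 1 y)
      = ∑ y : W.Out × W.Out, g (W.minus.prob 0 y) (W.minus.prob 1 y) := rfl
  rw [this]
  simp only [prob_minus_zero, prob_minus_one]

theorem sum_prod_mul (W : BDMC.{u}) (f g : W.Out → ℝ) :
    ∑ y : W.Out × W.Out, f y.1 * g y.2 = (∑ y, f y) * ∑ y, g y := by
  rw [Fintype.sum_prod_type, Finset.sum_mul_sum]

theorem bhattacharyya_nonneg (W : BDMC.{u}) : 0 ≤ W.bhattacharyya :=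
  Finset.sum_nonneg fun _ _ => Real.sqrt_nonneg _

theorem tvDist_nonneg (W : BDMC.{u}) : 0 ≤ W.tvDist :=
  Finset.sum_nonneg fun _ _ => by positivity

theorem bhattacharyya_plus (W : BDMC.{u}) : W.plus.bhattacharyya = W.bhattacharyya ^ 2 := by
  unfold bhattacharyya
  rw [sum_plus W (fun a b => √(a * b)), sq, ← sum_prod_mul]
  refine Finset.sum_congr rfl fun y _ => ?_
  have h0 := W.prob_nonneg 0 y.1
  have h1 := W.prob_nonneg 1 y.1
  have h2 := W.prob_nonneg 0 y.2
  have h3 := W.prob_nonneg 1 y.2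
  have e : √(W.prob 0 y.1 * W.prob 0 y.2 / 2 * (W.prob 1 y.1 * W.prob 1 y.2 / 2))
      = √(W.prob 0 y.1 * W.prob 1 y.1) * √(W.prob 0 y.2 * W.prob 1 y.2) / 2 := by
    rw [← Real.sqrt_mul (by positivity), Real.sqrt_eq_iff_mul_self_eq (by positivity) (by positivity)]
    rw [div_mul_div_comm, div_mul_div_comm, Real.mul_self_sqrt (by positivity)]
    ring
  have e' : W.prob 1 y.1 * W.prob 0 y.2 / 2 * (W.prob 0 y.1 * W.prob 1 y.2 / 2)
      = W.prob 0 y.1 * W.prob 0 y.2 / 2 * (W.prob 1 y.1 * W.prob 1 y.2 / 2) := by ring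
  rw [e', e]; ring

/-- The difference of the two likelihoods of the minus channel factors as half the product of the
differences for W. -/
theorem tvDist_minus (W : BDMC.{u}) : W.minus.tvDist = W.tvDist ^ 2 := by
  unfold tvDist
  rw [sum_minus W (fun a b => |a - b| / 2), sq, ← sum_prod_mul]
  refine Finset.sum_congr rfl fun y _ => ?_
  rw [div_mul_div_comm, ← abs_mul]
  have e : (W.prob 0 y.1 * W.prob 0 y.2 + W.prob 1 y.1 * W.prob 1 y.2) / 2
      - (W.prob 1 y.1 * W.prob 0 y.2 + W.prob 0 y.1 * W.prob 1 y.2) / 2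
      = ((W.prob 0 y.1 - W.prob 1 y.1) * (W.prob 0 y.2 - W.prob 1 y.2)) / 2 := by ring
  rw [e, abs_div, abs_two]; ring

theorem sum_prob_add (W : BDMC.{u}) : ∑ y, (W.prob 0 y + W.prob 1 y) = 2 := by
  rw [Finset.sum_add_distrib, W.prob_sum, W.prob_sum]; norm_num

/-- With u = (a + b)(c - d) and v = (a - b)(c + d), the left side is (|u + v| + |u - v|)/2 =
max(|u|, |v|). The right side is at least that, because min(|u|, |v|) ≥ |a - b| |c - d|. -/
theorem abs_mul_sub_add_abs_mul_sub_le {a b c d : ℝ} (ha : 0 ≤ a) (hb : 0 ≤ b) (hc : 0 ≤ c)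
    (hd : 0 ≤ d) : |a * c - b * d| + |b * c - a * d|
      ≤ (a + b) * |c - d| + |a - b| * (c + d) - |a - b| * |c - d| := by
  rcases abs_cases (a * c - b * d) with ⟨h1, _⟩ | ⟨h1, _⟩ <;>
  rcases abs_cases (b * c - a * d) with ⟨h2, _⟩ | ⟨h2, _⟩ <;>
  rcases abs_cases (a - b) with ⟨h3, _⟩ | ⟨h3, _⟩ <;>
  rcases abs_cases (c - d) with ⟨h4, _⟩ | ⟨h4, _⟩ <;>
  rw [h1, h2, h3, h4] <;>
  nlinarith [mul_nonneg ha hc, mul_nonneg ha hd, mul_nonneg hb hc, mul_nonneg hb hd]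

theorem tvDist_plus_le (W : BDMC.{u}) : W.plus.tvDist ≤ 2 * W.tvDist - W.tvDist ^ 2 := by
  have hR : 2 * W.tvDist - W.tvDist ^ 2 = ∑ y : W.Out × W.Out,
      ((W.prob 0 y.1 + W.prob 1 y.1) * (|W.prob 0 y.2 - W.prob 1 y.2| / 2) / 2
        + (|W.prob 0 y.1 - W.prob 1 y.1| / 2) * (W.prob 0 y.2 + W.prob 1 y.2) / 2
        - (|W.prob 0 y.1 - W.prob 1 y.1| / 2) * (|W.prob 0 y.2 - W.prob 1 y.2| / 2)) := by
    rw [Finset.sum_sub_distrib, Finset.sum_add_distrib, ← Finset.sum_div, ← Finset.sum_div,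
      sum_prod_mul W (fun y => W.prob 0 y + W.prob 1 y) (fun y => |W.prob 0 y - W.prob 1 y| / 2),
      sum_prod_mul W (fun y => |W.prob 0 y - W.prob 1 y| / 2) (fun y => W.prob 0 y + W.prob 1 y),
      sum_prod_mul W (fun y => |W.prob 0 y - W.prob 1 y| / 2)
        (fun y => |W.prob 0 y - W.prob 1 y| / 2), sum_prob_add]
    simp only [tvDist]; ring
  rw [hR]
  unfold tvDist
  rw [sum_plus W (fun a b => |a - b| / 2)]
  refine Finset.sum_le_sum fun y _ => ?_
  have h := abs_mul_sub_add_abs_mul_sub_le (W.prob_nonneg 0 y.1) (W.prob_nonneg 1 y.1)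
    (W.prob_nonneg 0 y.2) (W.prob_nonneg 1 y.2)
  rw [← sub_div, ← sub_div, abs_div, abs_div, abs_two]
  linarith

/-- With x = √(ab) and y = √(cd), the squares of the two sides differ by 2xy (a + b - 2x)(c + d -
2y), which is nonnegative by AM-GM. -/
theorem sqrt_mul_add_mul_le {a b c d : ℝ} (ha : 0 ≤ a) (hb : 0 ≤ b) (hc : 0 ≤ c) (hd : 0 ≤ d) :
    √((a * c + b * d) * (b * c + a * d))
      ≤ (a + b) * √(c * d) + √(a * b) * (c + d) - 2 * (√(a * b) * √(c * d)) := by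
  have hx := Real.sq_sqrt (mul_nonneg ha hb)
  have hy := Real.sq_sqrt (mul_nonneg hc hd)
  have hx0 := Real.sqrt_nonneg (a * b)
  have hy0 := Real.sqrt_nonneg (c * d)
  set x := √(a * b)
  set y := √(c * d)
  have hA : 2 * x ≤ a + b := by nlinarith [sq_nonneg (a - b)]
  have hB : 2 * y ≤ c + d := by nlinarith [sq_nonneg (c - d)]
  apply Real.sqrt_le_iff.2
  constructor
  · nlinarith [mul_nonneg hx0 hy0, mul_le_mul_of_nonneg_right hA hy0,
      mul_le_mul_of_nonneg_left hB hx0]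
  · have e : (a * c + b * d) * (b * c + a * d)
        = y ^ 2 * (a + b) ^ 2 + x ^ 2 * (c + d) ^ 2 - 4 * (x ^ 2 * y ^ 2) := by
      rw [hx, hy]; ring
    have h : 0 ≤ 2 * (x * y) * ((a + b - 2 * x) * (c + d - 2 * y)) :=
      mul_nonneg (by positivity) (mul_nonneg (by linarith) (by linarith))
    rw [e]
    linarith [h, show ((a + b) * y + x * (c + d) - 2 * (x * y)) ^ 2
      - (y ^ 2 * (a + b) ^ 2 + x ^ 2 * (c + d) ^ 2 - 4 * (x ^ 2 * y ^ 2))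
      = 2 * (x * y) * ((a + b - 2 * x) * (c + d - 2 * y)) by ring]

theorem bhattacharyya_minus_le (W : BDMC.{u}) :
    W.minus.bhattacharyya ≤ 2 * W.bhattacharyya - W.bhattacharyya ^ 2 := by
  have hR : 2 * W.bhattacharyya - W.bhattacharyya ^ 2 = ∑ y : W.Out × W.Out,
      ((W.prob 0 y.1 + W.prob 1 y.1) * √(W.prob 0 y.2 * W.prob 1 y.2) / 2
        + √(W.prob 0 y.1 * W.prob 1 y.1) * (W.prob 0 y.2 + W.prob 1 y.2) / 2
        - √(W.prob 0 y.1 * W.prob 1 y.1) * √(W.prob 0 y.2 * W.prob 1 y.2)) := by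
    rw [Finset.sum_sub_distrib, Finset.sum_add_distrib, ← Finset.sum_div, ← Finset.sum_div,
      sum_prod_mul W (fun y => W.prob 0 y + W.prob 1 y) (fun y => √(W.prob 0 y * W.prob 1 y)),
      sum_prod_mul W (fun y => √(W.prob 0 y * W.prob 1 y)) (fun y => W.prob 0 y + W.prob 1 y),
      sum_prod_mul W (fun y => √(W.prob 0 y * W.prob 1 y))
        (fun y => √(W.prob 0 y * W.prob 1 y)), sum_prob_add]
    simp only [bhattacharyya]; ring
  rw [hR]
  unfold bhattacharyya
  rw [sum_minus W (fun a b => √(a * b))]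
  refine Finset.sum_le_sum fun y _ => ?_
  have h := sqrt_mul_add_mul_le (W.prob_nonneg 0 y.1) (W.prob_nonneg 1 y.1)
    (W.prob_nonneg 0 y.2) (W.prob_nonneg 1 y.2)
  rw [div_mul_div_comm, Real.sqrt_div' _ (by norm_num), show (2 : ℝ) * 2 = 2 ^ 2 by norm_num,
    Real.sqrt_sq zero_le_two]
  linarith

/-- Termwise, (a + b)/2 - |a - b|/2 = min(a, b) ≤ √(ab). -/
theorem one_sub_bhattacharyya_le_tvDist (W : BDMC.{u}) : 1 - W.bhattacharyya ≤ W.tvDist := by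
  have : (1 : ℝ) = ∑ y, (W.prob 0 y + W.prob 1 y) / 2 := by
    rw [← Finset.sum_div, sum_prob_add]; norm_num
  rw [this]
  unfold bhattacharyya tvDist
  rw [← Finset.sum_sub_distrib]
  refine Finset.sum_le_sum fun y _ => ?_
  have ha := W.prob_nonneg 0 y
  have hb := W.prob_nonneg 1 y
  have hmin : ∀ {a b : ℝ}, 0 ≤ a → a ≤ b → a ≤ √(a * b) := fun h0 h =>
    Real.le_sqrt_of_sq_le (by nlinarith)
  rcases le_total (W.prob 0 y) (W.prob 1 y) with h | h
  · rw [abs_of_nonpos (by linarith)]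
    linarith [hmin ha h]
  · rw [abs_of_nonneg (by linarith), mul_comm]
    linarith [hmin hb h]

/-- Cauchy-Schwarz applied to |a - b| = |√a - √b| (√a + √b); the two sums of squares are 2 - 2Z and
2 + 2Z. -/
theorem tvDist_sq_add_bhattacharyya_sq_le (W : BDMC.{u}) :
    W.tvDist ^ 2 + W.bhattacharyya ^ 2 ≤ 1 := by
  have hcs := Finset.sum_mul_sq_le_sq_mul_sq Finset.univ
    (fun y => |√(W.prob 0 y) - √(W.prob 1 y)|) (fun y => √(W.prob 0 y) + √(W.prob 1 y))
  have e1 : ∑ y, |√(W.prob 0 y) - √(W.prob 1 y)| * (√(W.prob 0 y) + √(W.prob 1 y))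
      = 2 * W.tvDist := by
    unfold tvDist
    rw [Finset.mul_sum]
    refine Finset.sum_congr rfl fun y _ => ?_
    rw [← abs_of_nonneg (add_nonneg (Real.sqrt_nonneg (W.prob 0 y))
      (Real.sqrt_nonneg (W.prob 1 y))), ← abs_mul]
    have : (√(W.prob 0 y) - √(W.prob 1 y)) * (√(W.prob 0 y) + √(W.prob 1 y))
        = W.prob 0 y - W.prob 1 y := by
      linarith [Real.mul_self_sqrt (W.prob_nonneg 0 y), Real.mul_self_sqrt (W.prob_nonneg 1 y)]
    rw [this]; ring
  have e2 : ∑ y, |√(W.prob 0 y) - √(W.prob 1 y)| ^ 2 = 2 - 2 * W.bhattacharyya := by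
    trans ∑ y, (W.prob 0 y + W.prob 1 y) - 2 * W.bhattacharyya
    swap; · rw [sum_prob_add]
    rw [bhattacharyya, Finset.mul_sum, ← Finset.sum_sub_distrib]
    refine Finset.sum_congr rfl fun y _ => ?_
    rw [sq_abs, Real.sqrt_mul (W.prob_nonneg 0 y), sub_sq, Real.sq_sqrt (W.prob_nonneg 0 y),
      Real.sq_sqrt (W.prob_nonneg 1 y)]; ring
  have e3 : ∑ y, (√(W.prob 0 y) + √(W.prob 1 y)) ^ 2 = 2 + 2 * W.bhattacharyya := by
    trans ∑ y, (W.prob 0 y + W.prob 1 y) + 2 * W.bhattacharyya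
    swap; · rw [sum_prob_add]
    rw [bhattacharyya, Finset.mul_sum, ← Finset.sum_add_distrib]
    refine Finset.sum_congr rfl fun y _ => ?_
    rw [Real.sqrt_mul (W.prob_nonneg 0 y), add_sq, Real.sq_sqrt (W.prob_nonneg 0 y),
      Real.sq_sqrt (W.prob_nonneg 1 y)]; ring
  rw [e1, e2, e3] at hcs
  linarith

theorem squaresOrDoubles_bhattacharyya : SquaresOrDoubles bhattacharyya.{u} := fun W =>
  .inr ⟨W.bhattacharyya_plus.le, by linarith [W.bhattacharyya_minus_le, sq_nonneg W.bhattacharyya]⟩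

theorem squaresOrDoubles_tvDist : SquaresOrDoubles tvDist.{u} := fun W =>
  .inl ⟨W.tvDist_minus.le, by linarith [W.tvDist_plus_le, sq_nonneg W.tvDist]⟩

/-! ### Contraction of √(T Z) -/

/-- Put w = (1 - T)(1 - Z). The two radicands add up to 2 - 2w, and T Z ≤ 1/2 bounds the product of
the roots by 7/8 + w. The w cancels when the sum is squared, leaving 2 + 7/4 = 15/4. -/
theorem sqrt_add_sqrt_le {T Z : ℝ} (hT : 0 ≤ T) (hZ : 0 ≤ Z) (hTZ : T ^ 2 + Z ^ 2 ≤ 1) :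
    √(T * (2 - Z)) + √(Z * (2 - T)) ≤ 2 * √(15 / 16) := by
  have hT1 : T ≤ 1 := by nlinarith
  have hZ1 : Z ≤ 1 := by nlinarith
  have hq : T * Z ≤ 1 / 2 := by nlinarith [sq_nonneg (T - Z)]
  have hw : 0 ≤ (1 - T) * (1 - Z) := mul_nonneg (by linarith) (by linarith)
  have ha : 0 ≤ T * (2 - Z) := mul_nonneg hT (by linarith)
  have hb : 0 ≤ Z * (2 - T) := mul_nonneg hZ (by linarith)
  have hab : √(T * (2 - Z)) * √(Z * (2 - T)) ≤ 7 / 8 + (1 - T) * (1 - Z) := by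
    rw [← Real.sqrt_mul ha]
    refine Real.sqrt_le_iff.2 ⟨by linarith, ?_⟩
    have e : T * (2 - Z) * (Z * (2 - T)) = T * Z * (2 + 2 * ((1 - T) * (1 - Z)) - T * Z) := by
      ring
    rw [e]
    nlinarith [mul_nonneg hT hZ]
  have h2 : 2 * √(15 / 16) = √(15 / 4) := by
    rw [show (15 / 4 : ℝ) = 2 ^ 2 * (15 / 16) by norm_num, Real.sqrt_mul (by norm_num),
      Real.sqrt_sq zero_le_two]
  rw [h2]
  refine Real.le_sqrt_of_sq_le ?_
  rw [add_sq, Real.sq_sqrt ha, Real.sq_sqrt hb]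
  linarith

/-- The product T Z becomes at most T Z · T(2 - Z) after a minus split and at most T Z · Z(2 - T)
after a plus split. -/
theorem splitMean_sqrt_tvDist_mul_bhattacharyya_le (W : BDMC.{u}) :
    splitMean (fun V => √(V.tvDist * V.bhattacharyya)) W
      ≤ √(15 / 16) * √(W.tvDist * W.bhattacharyya) := by
  have hT := W.tvDist_nonneg
  have hZ := W.bhattacharyya_nonneg
  have h1 : √(W.minus.tvDist * W.minus.bhattacharyya)
      ≤ √(W.tvDist * W.bhattacharyya) * √(W.tvDist * (2 - W.bhattacharyya)) := by
    rw [← Real.sqrt_mul (by positivity), tvDist_minus]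
    refine Real.sqrt_le_sqrt ?_
    nlinarith [mul_le_mul_of_nonneg_left W.bhattacharyya_minus_le (sq_nonneg W.tvDist)]
  have h2 : √(W.plus.tvDist * W.plus.bhattacharyya)
      ≤ √(W.tvDist * W.bhattacharyya) * √(W.bhattacharyya * (2 - W.tvDist)) := by
    rw [← Real.sqrt_mul (by positivity), bhattacharyya_plus]
    refine Real.sqrt_le_sqrt ?_
    nlinarith [mul_le_mul_of_nonneg_left W.tvDist_plus_le (sq_nonneg W.bhattacharyya)]
  have h3 := mul_le_mul_of_nonneg_left
    (sqrt_add_sqrt_le hT hZ W.tvDist_sq_add_bhattacharyya_sq_le)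
    (Real.sqrt_nonneg (W.tvDist * W.bhattacharyya))
  unfold splitMean
  linarith

/-! ### Symmetric information: conservation and comparison with T and Z -/

open Real in
/-- The symmetric mutual information through the entropy function `negMulLog`, in nats. -/
theorem symmInfo_mul_log_two (W : BDMC.{u}) : W.symmInfo * log 2
    = ∑ y, negMulLog ((W.prob 0 y + W.prob 1 y) / 2)
      - ∑ y, (negMulLog (W.prob 0 y) + negMulLog (W.prob 1 y)) / 2 := by
  have hl : log 2 ≠ 0 := (log_pos one_lt_two).ne'
  unfold symmInfo
  rw [sum_zmod_two, ← Finset.sum_add_distrib, Finset.sum_mul, ← Finset.sum_sub_distrib]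
  refine Finset.sum_congr rfl fun y _ => ?_
  have ho : W.outProb y = (W.prob 0 y + W.prob 1 y) / 2 := by
    rw [outProb, sum_zmod_two]; ring
  have h0 := W.prob_nonneg 0 y
  have h1 := W.prob_nonneg 1 y
  rw [ho]
  have key : ∀ a m : ℝ, (a ≠ 0 → m ≠ 0) →
      (1 / 2) * a * logb 2 (a / m) * log 2 = (a * log a - a * log m) / 2 := by
    intro a m h
    rcases eq_or_ne a 0 with rfl | ha
    · simp
    · rw [logb, log_div ha (h ha)]; field_simp
  rw [add_mul, key _ _ (fun h => by positivity), key _ _ (fun h => by positivity)]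
  simp only [negMulLog]; ring

-- This is the chain rule for mutual information. Letter by letter, the entropies of the mixtures
-- (ac + bd)/2 and (bc + ad)/2 enter the minus and plus channels with opposite signs and cancel, up
-- to terms in log 2. The rest splits by the product rule `negMulLog_mul`.
open Real in
theorem symmInfo_minus_add_symmInfo_plus (W : BDMC.{u}) :
    W.minus.symmInfo + W.plus.symmInfo = 2 * W.symmInfo := by
  have hl : log 2 ≠ 0 := (log_pos one_lt_two).ne'
  apply mul_right_cancel₀ hl
  rw [add_mul, mul_assoc, symmInfo_mul_log_two, symmInfo_mul_log_two, symmInfo_mul_log_two,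
    sum_minus W (fun a b => negMulLog ((a + b) / 2)),
    sum_minus W (fun a b => (negMulLog a + negMulLog b) / 2),
    sum_plus W (fun a b => negMulLog ((a + b) / 2)),
    sum_plus W (fun a b => (negMulLog a + negMulLog b) / 2),
    ← Finset.sum_sub_distrib, ← Finset.sum_sub_distrib, ← Finset.sum_add_distrib,
    ← Finset.sum_sub_distrib]
  have h2 : negMulLog 2⁻¹ = log 2 / 2 := by rw [negMulLog, log_inv]; ring
  have hhalf : ∀ x : ℝ, negMulLog (x / 2) = negMulLog x / 2 + x * (log 2 / 2) := by
    intro x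
    rw [div_eq_mul_inv, negMulLog_mul, h2]; ring
  have hR : 2 * ∑ y, (negMulLog ((W.prob 0 y + W.prob 1 y) / 2)
        - (negMulLog (W.prob 0 y) + negMulLog (W.prob 1 y)) / 2)
      = ∑ y : W.Out × W.Out,
        ((negMulLog ((W.prob 0 y.1 + W.prob 1 y.1) / 2)
          - (negMulLog (W.prob 0 y.1) + negMulLog (W.prob 1 y.1)) / 2)
            * ((W.prob 0 y.2 + W.prob 1 y.2) / 2)
        + (W.prob 0 y.1 + W.prob 1 y.1) / 2 * (negMulLog ((W.prob 0 y.2 + W.prob 1 y.2) / 2)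
          - (negMulLog (W.prob 0 y.2) + negMulLog (W.prob 1 y.2)) / 2)) := by
    rw [Finset.sum_add_distrib,
      sum_prod_mul W (fun y => negMulLog ((W.prob 0 y + W.prob 1 y) / 2)
          - (negMulLog (W.prob 0 y) + negMulLog (W.prob 1 y)) / 2)
        (fun y => (W.prob 0 y + W.prob 1 y) / 2),
      sum_prod_mul W (fun y => (W.prob 0 y + W.prob 1 y) / 2)
        (fun y => negMulLog ((W.prob 0 y + W.prob 1 y) / 2)
          - (negMulLog (W.prob 0 y) + negMulLog (W.prob 1 y)) / 2),
      ← Finset.sum_div, sum_prob_add]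
    ring
  rw [hR]
  refine Finset.sum_congr rfl fun y _ => ?_
  generalize W.prob 0 y.1 = a
  generalize W.prob 1 y.1 = b
  generalize W.prob 0 y.2 = c
  generalize W.prob 1 y.2 = d
  have e1 : ((a * c + b * d) / 2 + (b * c + a * d) / 2) / 2 = (a + b) / 2 * ((c + d) / 2) := by
    ring
  have e2 : (a * c / 2 + b * d / 2) / 2 = (a * c + b * d) / 2 / 2 := by ring
  have e3 : (b * c / 2 + a * d / 2) / 2 = (b * c + a * d) / 2 / 2 := by ring
  rw [e1, e2, e3, negMulLog_mul, hhalf ((a * c + b * d) / 2), hhalf ((b * c + a * d) / 2),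
    hhalf (a * c), hhalf (b * d), hhalf (b * c), hhalf (a * d), negMulLog_mul, negMulLog_mul,
    negMulLog_mul, negMulLog_mul]
  ring

theorem splitMean_symmInfo (W : BDMC.{u}) : splitMean symmInfo W = W.symmInfo := by
  rw [splitMean, symmInfo_minus_add_symmInfo_plus]; ring

open Real in
/-- The summands of the symmetric information (in nats) are controlled by elementary functions. -/
theorem mutualInfo_summand_bounds {a b : ℝ} (ha : 0 ≤ a) (hb : 0 ≤ b) :
    let t := negMulLog ((a + b) / 2) - (negMulLog a + negMulLog b) / 2
    0 ≤ t ∧ t ≤ (a + b) / 2 * log 2 ∧ t ≤ |a - b| / 2 ∧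
      (a + b) / 2 * log 2 - 2 * √(a * b) ≤ t := by
  intro t
  rcases ha.eq_or_lt with rfl | ha'
  · have : t = b / 2 * log 2 := by
      rcases hb.eq_or_lt with rfl | hb'
      · simp [t]
      · simp only [t, negMulLog, zero_add, log_div hb'.ne' two_ne_zero]
        simp; ring
    have h2 : 0 < log 2 := log_pos one_lt_two
    have h3 : log 2 ≤ 1 := by linarith [log_two_lt_d9]
    rw [this]
    refine ⟨by positivity, by simp, ?_, by simp⟩
    rw [zero_sub, abs_neg, abs_of_nonneg hb]
    nlinarith
  rcases hb.eq_or_lt with rfl | hb'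
  · have : t = a / 2 * log 2 := by
      simp only [t, negMulLog, add_zero, log_div ha'.ne' two_ne_zero]
      simp; ring
    have h2 : 0 < log 2 := log_pos one_lt_two
    have h3 : log 2 ≤ 1 := by linarith [log_two_lt_d9]
    rw [this]
    refine ⟨by positivity, by simp, ?_, by simp⟩
    rw [sub_zero, abs_of_nonneg ha]
    nlinarith
  set m := (a + b) / 2 with hm
  have hm0 : 0 < m := by positivity
  have ht : t = (a * log (a / m) + b * log (b / m)) / 2 := by
    simp only [t, negMulLog, log_div ha'.ne' hm0.ne', log_div hb'.ne' hm0.ne']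
    linear_combination -log m * hm
  have hla : log (a / m) ≤ a / m - 1 := log_le_sub_one_of_pos (by positivity)
  have hlb : log (b / m) ≤ b / m - 1 := log_le_sub_one_of_pos (by positivity)
  have hla' := one_sub_inv_le_log_of_pos (show 0 < a / m by positivity)
  have hlb' := one_sub_inv_le_log_of_pos (show 0 < b / m by positivity)
  -- Write log((x + y)/x) as 2 log(√(x + y)/√x), then use log z ≤ z - 1 and √(x + y) ≤ √x + √y.
  have hsqrt : ∀ {x y : ℝ}, 0 < x → 0 < y →
      x * (log (x + y) - log x) ≤ 2 * (√x * √y) := by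
    intro x y hx hy
    have hs : √(x + y) ≤ √x + √y := by
      refine Real.sqrt_le_iff.2 ⟨by positivity, ?_⟩
      rw [add_sq, sq_sqrt hx.le, sq_sqrt hy.le]
      have : 0 ≤ √x * √y := by positivity
      linarith
    have h := log_le_sub_one_of_pos (show 0 < √(x + y) / √x by positivity)
    rw [log_div (by positivity) (by positivity), log_sqrt (by positivity), log_sqrt hx.le] at h
    have h' := mul_le_mul_of_nonneg_left h hx.le
    have e : x * (√(x + y) / √x - 1) = √x * √(x + y) - x := by
      rw [mul_sub, mul_one, mul_div_assoc', mul_comm x, mul_div_assoc, div_sqrt, mul_comm]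
    have h3 := mul_le_mul_of_nonneg_left hs (sqrt_nonneg x)
    rw [mul_add, mul_self_sqrt hx.le] at h3
    rw [e] at h'
    linarith
  have hml : m * log 2 = (a * log 2 + b * log 2) / 2 := by rw [hm]; ring
  refine ⟨?_, ?_, ?_, ?_⟩
  · have h1 := mul_le_mul_of_nonneg_left hla' ha
    have h2 := mul_le_mul_of_nonneg_left hlb' hb
    have e1 : a * (1 - (a / m)⁻¹) = a - m := by field_simp
    have e2 : b * (1 - (b / m)⁻¹) = b - m := by field_simp
    rw [e1] at h1
    rw [e2] at h2
    rw [ht]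
    linarith
  · have h1 : log (a / m) ≤ log 2 := log_le_log (by positivity) (by
      rw [div_le_iff₀ hm0]; linarith)
    have h2 : log (b / m) ≤ log 2 := log_le_log (by positivity) (by
      rw [div_le_iff₀ hm0]; linarith)
    rw [ht, hml]
    linarith [mul_le_mul_of_nonneg_left h1 ha, mul_le_mul_of_nonneg_left h2 hb]
  · have h1 := mul_le_mul_of_nonneg_left hla ha
    have h2 := mul_le_mul_of_nonneg_left hlb hb
    -- The inequality log z ≤ z - 1 bounds the divergence by (a - b)²/(a + b), which is at most |a -
    -- b|.
    have h3 : a * (a / m - 1) + b * (b / m - 1) = |a - b| * (|a - b| / (a + b)) := by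
      rw [mul_div_assoc', abs_mul_abs_self, hm]
      field_simp
      ring
    have h4 : |a - b| / (a + b) ≤ 1 := by
      rw [div_le_one (by positivity), abs_le]
      constructor <;> linarith
    have h5 := mul_le_mul_of_nonneg_left h4 (abs_nonneg (a - b))
    rw [ht]
    linarith
  · have h1 := hsqrt ha' hb'
    have h2 := hsqrt hb' ha'
    have h3 : log m = log (a + b) - log 2 := by rw [hm, log_div (by positivity) two_ne_zero]
    rw [add_comm b a, mul_comm √b] at h2
    rw [← sqrt_mul ha] at h1 h2
    rw [ht, log_div ha'.ne' hm0.ne', log_div hb'.ne' hm0.ne', h3, hml]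
    linarith

theorem symmInfo_mul_log_two' (W : BDMC.{u}) : W.symmInfo * Real.log 2
    = ∑ y, (((W.prob 0 y + W.prob 1 y) / 2).negMulLog
      - ((W.prob 0 y).negMulLog + (W.prob 1 y).negMulLog) / 2) := by
  rw [symmInfo_mul_log_two, Finset.sum_sub_distrib]

theorem sum_prob_add_div_two_mul (W : BDMC.{u}) (c : ℝ) :
    ∑ y, (W.prob 0 y + W.prob 1 y) / 2 * c = c := by
  rw [← Finset.sum_mul, ← Finset.sum_div, sum_prob_add]; ring

theorem symmInfo_nonneg (W : BDMC.{u}) : 0 ≤ W.symmInfo := by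
  refine nonneg_of_mul_nonneg_left ?_ (Real.log_pos one_lt_two)
  rw [symmInfo_mul_log_two']
  exact Finset.sum_nonneg fun y _ => (mutualInfo_summand_bounds (W.prob_nonneg 0 y)
    (W.prob_nonneg 1 y)).1

theorem symmInfo_le_one (W : BDMC.{u}) : W.symmInfo ≤ 1 := by
  refine le_of_mul_le_mul_right ?_ (Real.log_pos one_lt_two)
  rw [symmInfo_mul_log_two', one_mul, ← sum_prob_add_div_two_mul W (Real.log 2)]
  exact Finset.sum_le_sum fun y _ => (mutualInfo_summand_bounds (W.prob_nonneg 0 y)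
    (W.prob_nonneg 1 y)).2.1

theorem symmInfo_le_tvDist (W : BDMC.{u}) : W.symmInfo ≤ (Real.log 2)⁻¹ * W.tvDist := by
  rw [inv_mul_eq_div, le_div_iff₀ (Real.log_pos one_lt_two), symmInfo_mul_log_two']
  exact Finset.sum_le_sum fun y _ => (mutualInfo_summand_bounds (W.prob_nonneg 0 y)
    (W.prob_nonneg 1 y)).2.2.1

theorem one_sub_symmInfo_le_bhattacharyya (W : BDMC.{u}) :
    1 - W.symmInfo ≤ 2 * (Real.log 2)⁻¹ * W.bhattacharyya := by
  have h : Real.log 2 - 2 * W.bhattacharyya ≤ W.symmInfo * Real.log 2 := by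
    rw [symmInfo_mul_log_two', bhattacharyya, Finset.mul_sum]
    nth_rewrite 1 [← sum_prob_add_div_two_mul W (Real.log 2)]
    rw [← Finset.sum_sub_distrib]
    exact Finset.sum_le_sum fun y _ => (mutualInfo_summand_bounds (W.prob_nonneg 0 y)
      (W.prob_nonneg 1 y)).2.2.2
  have e : 2 * (Real.log 2)⁻¹ * W.bhattacharyya = 2 * W.bhattacharyya / Real.log 2 := by ring
  rw [e, le_div_iff₀ (Real.log_pos one_lt_two)]
  linarith

/-! ### Polarization and its rate -/

/-- Polarization: if `√(X Y)` contracts under splitting and `J ≤ min 1 (C Y)` is preserved on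
average, then `X` is small with probability at least about `J W`. -/
theorem le_pathProb_of_contraction {X Y J : BDMC.{u} → ℝ} {C ρ : ℝ} (hC : 0 ≤ C) (hρ : 0 ≤ ρ)
    (hXY : ∀ V, splitMean (fun U => √(X U * Y U)) V ≤ ρ * √(X V * Y V))
    (hJ : ∀ V, splitMean J V = J V) (hJ1 : ∀ V, J V ≤ 1) (hJY : ∀ V, J V ≤ C * Y V)
    (n : ℕ) {s : ℝ} (hs : 0 < s) (W : BDMC.{u}) :
    J W ≤ pathProb n {V | X V ≤ s} W + C * s + ρ ^ n / s * √(X W * Y W) := by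
  -- Three cases: X ≤ s is counted by the indicator; if X > s and Y ≤ s then J ≤ C s; if both exceed
  -- s then √(X Y) > s and the last term exceeds 1, as in Markov's inequality.
  have key : ∀ V, J V ≤ {V | X V ≤ s}.indicator 1 V + (C * s + s⁻¹ * √(X V * Y V)) := by
    intro V
    have h0 : 0 ≤ s⁻¹ * √(X V * Y V) := by positivity
    have h1 : 0 ≤ C * s := by positivity
    by_cases hX : X V ≤ s
    · rw [Set.indicator_of_mem (show V ∈ {V | X V ≤ s} from hX), Pi.one_apply]
      linarith [hJ1 V]
    · rw [Set.indicator_of_notMem (show V ∉ {V | X V ≤ s} from hX), zero_add]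
      rcases le_or_gt (Y V) s with hY | hY
      · linarith [hJY V, mul_le_mul_of_nonneg_left hY hC]
      · have : s ≤ √(X V * Y V) := Real.le_sqrt_of_sq_le (by nlinarith)
        have : 1 ≤ s⁻¹ * √(X V * Y V) := by
          rw [inv_mul_eq_div, le_div_iff₀ hs]; linarith
        linarith [hJ1 V]
  calc J W = pathMean n J W := by rw [pathMean_eq_self n hJ]
    _ ≤ _ := pathMean_mono n key W
    _ = pathProb n {V | X V ≤ s} W + (C * s + s⁻¹ * pathMean n (fun V => √(X V * Y V)) W) := by
      rw [pathMean_add, pathMean_add, pathMean_const, pathMean_const_mul]; rfl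
    _ ≤ pathProb n {V | X V ≤ s} W + (C * s + s⁻¹ * (ρ ^ n * √(X W * Y W))) := by
      have := pathMean_le_pow_mul n hρ hXY W
      gcongr
    _ = _ := by ring

/-- From exponentially small values of `X` to doubly exponentially small ones. -/
theorem pathProb_lt_le {X : BDMC.{u} → ℝ} (hX0 : ∀ W, 0 ≤ X W) (hX : SquaresOrDoubles X)
    {α : ℝ} (hα : α ≤ 1 / 2) (m l j : ℕ) (hj : (j + 1 : ℝ) ≤ l * 2 ^ ((1 / 4 : ℝ) * l))
    (W : BDMC.{u}) :
    pathProb (m + (l + j)) {V | (2 : ℝ) ^ (-((2 : ℝ) ^ (α * j))) < X V} W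
      ≤ pathProb m {V | X V ≤ (2 : ℝ) ^ (-(2 * l : ℝ))}ᶜ W
        + (Real.exp (-2 * (1 / 2 - 1 / 4) ^ 2) ^ l + Real.exp (-2 * (1 / 2 - α) ^ 2) ^ j) := by
  refine pathProb_add_steps_le m (l + j) (by positivity) (fun V hV => ?_) W
  have hV : X V ≤ (2 : ℝ) ^ (-(2 * l : ℝ)) := by simpa using hV
  -- Starting from exponent 2l, l steps lose at most l. The crude rate 1/4 then yields exponent l
  -- 2^(l/4), large enough to absorb the j losses of the final stretch.
  have h1 := pathProb_tail_le_exp hX0 hX (α := 1 / 4) (by norm_num) l (2 * l) V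
    (by linarith [(Nat.cast_nonneg l : (0 : ℝ) ≤ l)]) hV
  refine (pathProb_add_steps_le l j (by positivity) (fun U hU => ?_) V).trans
    (add_le_add_left h1 _)
  have hU : X U ≤ (2 : ℝ) ^ (-((l : ℝ) * 2 ^ ((1 / 4 : ℝ) * l))) := by
    have : X U ≤ (2 : ℝ) ^ (-((2 * l - l : ℝ) * 2 ^ ((1 / 4 : ℝ) * l))) := by simpa using hU
    rwa [show (2 * l - l : ℝ) = l by ring] at this
  refine (pathProb_mono j ?_ U).trans (pathProb_tail_le_exp hX0 hX hα j _ U (by linarith) hU)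
  -- By `hj` the exponent exceeds j by at least 1, so (L - j) 2^(αj) ≥ 2^(αj).
  intro V hV
  refine lt_of_le_of_lt (Real.rpow_le_rpow_of_exponent_le one_le_two ?_) hV
  have : (0 : ℝ) < 2 ^ (α * j) := by positivity
  nlinarith

/-- A path of length n is cut as K l + l + j with l = n / M: polarization, then a crude
amplification, then the main stretch at rate α in (β, 1/2). The first two phases take a fraction of
n small enough that α j ≥ β n. -/
theorem eventually_le_pathProb {X Y J : BDMC.{u} → ℝ} {C ρ : ℝ} (hC : 0 ≤ C) (hρ : 0 ≤ ρ)
    (hρ1 : ρ < 1) (hX0 : ∀ W, 0 ≤ X W) (hX : SquaresOrDoubles X)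
    (hXY : ∀ V, splitMean (fun U => √(X U * Y U)) V ≤ ρ * √(X V * Y V))
    (hJ : ∀ V, splitMean J V = J V) (hJ1 : ∀ V, J V ≤ 1) (hJY : ∀ V, J V ≤ C * Y V)
    {β : ℝ} (hβ : β < 1 / 2) (W : BDMC.{u}) {ε : ℝ} (hε : 0 < ε) :
    ∀ᶠ n : ℕ in atTop,
      J W - ε < pathProb n {V | X V ≤ (2 : ℝ) ^ (-((2 : ℝ) ^ ((n : ℝ) * β)))} W := by
  -- For β ≤ 0 the threshold is at least the one for 1/4, so the event only grows. Positivity of β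
  -- is needed to get M > K + 1.
  wlog hβ0 : 0 < β generalizing β
  · filter_upwards [this (β := 1 / 4) (by norm_num) (by norm_num)] with n hn
    refine hn.trans_le (pathProb_mono n (fun V hV => ?_) W)
    have hV : X V ≤ (2 : ℝ) ^ (-((2 : ℝ) ^ ((n : ℝ) * (1 / 4)))) := hV
    refine hV.trans (?_ : _ ≤ (2 : ℝ) ^ (-((2 : ℝ) ^ ((n : ℝ) * β))))
    refine Real.rpow_le_rpow_of_exponent_le one_le_two (neg_le_neg ?_)
    refine Real.rpow_le_rpow_of_exponent_le one_le_two ?_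
    exact mul_le_mul_of_nonneg_left (by linarith) n.cast_nonneg
  obtain ⟨α, hβα, hα⟩ := exists_between hβ
  have hα0 : 0 < α := hβ0.trans hβα
  -- The Markov term is ρ^(K l) divided by s = 4^(-l); the choice ρ^K < 1/8 makes the quotient at
  -- most 2^(-l).
  obtain ⟨K, hK⟩ := exists_pow_lt_of_lt_one (show (0 : ℝ) < 1 / 8 by norm_num) hρ1
  -- Since j = n - (K + 1) l and M l ≤ n, the bound β n ≤ α j follows from (K + 1) α ≤ M (α - β).
  obtain ⟨M, hM⟩ := exists_nat_gt ((K + 1) * α / (α - β))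
  have hM' : (K + 1) * α < M * (α - β) := by rwa [div_lt_iff₀ (by linarith)] at hM
  have hKM : K + 1 < M := by
    have : ((K + 1 : ℕ) : ℝ) < M := by
      push_cast
      by_contra! hcon
      have h1 := mul_le_mul_of_nonneg_right hcon (sub_nonneg.2 hβα.le)
      have h2 : (0 : ℝ) < (K + 1) * β := by positivity
      nlinarith
    exact_mod_cast this
  have hM0 : 0 < M := by omega
  set l : ℕ → ℕ := fun n => n / M with hl
  set j : ℕ → ℕ := fun n => n - (K * l n + l n) with hj
  have hlM : ∀ n, M * l n ≤ n := fun n => Nat.mul_div_le n M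
  have hlK : ∀ n, K * l n + l n ≤ M * l n := fun n => by
    have := Nat.mul_le_mul_right (l n) hKM.le
    rwa [add_mul, one_mul] at this
  have hsum : ∀ n, n = K * l n + (l n + j n) := fun n => by
    have := hlM n; have := hlK n; simp only [hj]; omega
  have hlt : Tendsto l atTop atTop := Nat.tendsto_div_const_atTop hM0.ne'
  have hlj : ∀ n, l n ≤ j n := fun n => by
    have h1 := hlM n
    have h2 := Nat.mul_le_mul_right (l n) (show K + 1 + 1 ≤ M from hKM)
    rw [add_mul, add_mul, one_mul] at h2
    simp only [hj]; omega
  have hjt : Tendsto j atTop atTop := tendsto_atTop_mono hlj hlt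
  have hβj : ∀ n : ℕ, (n : ℝ) * β ≤ α * j n := by
    intro n
    have h1 : (n : ℝ) = K * l n + (l n + j n) := by exact_mod_cast hsum n
    have h2 : (M : ℝ) * l n ≤ n := by exact_mod_cast hlM n
    have h3 := mul_le_mul_of_nonneg_right hM'.le (Nat.cast_nonneg (l n) : (0 : ℝ) ≤ l n)
    have h4 := mul_le_mul_of_nonneg_right h2 (sub_nonneg.2 hβα.le)
    have h5 : α * j n = α * n - (K + 1) * α * l n := by rw [h1]; ring
    rw [h5]
    nlinarith
  have hgrow : ∀ᶠ n in atTop, (j n + 1 : ℝ) ≤ l n * 2 ^ ((1 / 4 : ℝ) * l n) := by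
    have ht : Tendsto (fun n => (2 : ℝ) ^ ((1 / 4 : ℝ) * l n)) atTop atTop := by
      refine (tendsto_rpow_atTop_of_base_gt_one 2 one_lt_two).comp ?_
      exact (tendsto_natCast_atTop_atTop.comp hlt).const_mul_atTop (by norm_num)
    filter_upwards [ht.eventually_ge_atTop (2 * M + 1 : ℝ), hlt.eventually_ge_atTop 1] with n h1 h2
    have h3 : j n + 1 ≤ l n * (2 * M + 1) := by
      have h4 : n < M * (l n + 1) := Nat.lt_mul_div_succ n hM0
      have h5 : j n ≤ n := Nat.sub_le _ _
      have h6 : M * 1 ≤ M * l n := Nat.mul_le_mul_left M h2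
      nlinarith
    calc (j n + 1 : ℝ) ≤ l n * (2 * M + 1) := by exact_mod_cast h3
      _ ≤ _ := mul_le_mul_of_nonneg_left h1 (Nat.cast_nonneg _)
  set a := Real.exp (-2 * (1 / 2 - 1 / 4 : ℝ) ^ 2) with ha
  set b := Real.exp (-2 * (1 / 2 - α) ^ 2) with hb
  have ha1 : a < 1 := Real.exp_lt_one_iff.2 (by norm_num)
  have hb1 : b < 1 := Real.exp_lt_one_iff.2 (by nlinarith [sub_pos.2 hα])
  have hlim : Tendsto (fun n => C * (1 / 4 : ℝ) ^ l n + (1 / 2 : ℝ) ^ l n * √(X W * Y W)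
      + (a ^ l n + b ^ j n)) atTop (𝓝 0) := by
    have t1 := (tendsto_pow_atTop_nhds_zero_of_lt_one (r := (1 / 4 : ℝ)) (by norm_num)
      (by norm_num)).comp hlt
    have t2 := (tendsto_pow_atTop_nhds_zero_of_lt_one (r := (1 / 2 : ℝ)) (by norm_num)
      (by norm_num)).comp hlt
    have t3 := (tendsto_pow_atTop_nhds_zero_of_lt_one (Real.exp_pos _).le ha1).comp hlt
    have t4 := (tendsto_pow_atTop_nhds_zero_of_lt_one (Real.exp_pos _).le hb1).comp hjt
    have t := ((t1.const_mul C).add (t2.mul_const √(X W * Y W))).add (t3.add t4)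
    rwa [mul_zero, zero_mul, add_zero, add_zero] at t
  filter_upwards [hgrow, hlim.eventually_lt_const hε] with n hn hεn
  have hs : (2 : ℝ) ^ (-(2 * l n : ℝ)) = (1 / 4) ^ l n := by
    rw [Real.rpow_neg zero_le_two, Real.rpow_mul zero_le_two, Real.rpow_natCast, ← inv_pow]
    norm_num
  have h1 := le_pathProb_of_contraction hC hρ hXY hJ hJ1 hJY (K * l n)
    (show (0 : ℝ) < (1 / 4) ^ l n by positivity) W
  have h2 := pathProb_lt_le hX0 hX hα.le (K * l n) (l n) (j n) hn W
  rw [← hsum n, hs, pathProb_compl, ← ha, ← hb] at h2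
  have h3 : ρ ^ (K * l n) / (1 / 4) ^ l n ≤ (1 / 2) ^ l n := by
    rw [pow_mul, ← div_pow]
    refine pow_le_pow_left₀ (by positivity) ?_ _
    rw [div_le_iff₀ (by norm_num)]
    linarith
  have h4 := mul_le_mul_of_nonneg_right h3 (Real.sqrt_nonneg (X W * Y W))
  have h5 : pathProb n {V | X V ≤ (2 : ℝ) ^ (-((2 : ℝ) ^ ((n : ℝ) * β)))}ᶜ W
      ≤ pathProb n {V | (2 : ℝ) ^ (-((2 : ℝ) ^ (α * j n))) < X V} W := by
    refine pathProb_mono n (fun V hV => ?_) W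
    have hV : (2 : ℝ) ^ (-((2 : ℝ) ^ ((n : ℝ) * β))) < X V := not_le.1 hV
    refine lt_of_le_of_lt (Real.rpow_le_rpow_of_exponent_le one_le_two (neg_le_neg ?_)) hV
    exact Real.rpow_le_rpow_of_exponent_le one_le_two (hβj n)
  rw [pathProb_compl] at h5
  linarith

/-- For negative β the right side tends to 0, but only exponentially in n: Bernoulli's inequality
2^(-x) ≤ 1 - x/2 on [0, 1], at x = 2^(-κ n), bounds it below by 2^(-κ n - 1). The left side is
doubly exponentially small. -/
theorem eventually_rpow_neg_rpow_lt_one_sub (β : ℝ) :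
    ∀ᶠ n : ℕ in atTop, (2 : ℝ) ^ (-((2 : ℝ) ^ ((n : ℝ) * (1 / 4))))
      < 1 - (2 : ℝ) ^ (-((2 : ℝ) ^ ((n : ℝ) * β))) := by
  set κ : ℝ := max 0 (-β)
  have hκ0 : 0 ≤ κ := le_max_left _ _
  have hκβ : -κ ≤ β := by linarith [le_max_right 0 (-β)]
  have hr : (1 : ℝ) < 2 ^ (1 / 4 : ℝ) := Real.one_lt_rpow one_lt_two (by norm_num)
  have t1 := (tendsto_pow_const_div_const_pow_of_one_lt 1 hr).const_mul κ
  have t2 := tendsto_pow_const_div_const_pow_of_one_lt 0 hr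
  have t := t1.add t2
  rw [mul_zero, add_zero] at t
  filter_upwards [t.eventually_lt_const one_pos] with n hn
  have hA : κ * n + 1 < 2 ^ ((n : ℝ) * (1 / 4)) := by
    rw [mul_comm (n : ℝ), Real.rpow_mul zero_le_two, Real.rpow_natCast]
    rw [mul_div_assoc', ← add_div, div_lt_one (by positivity)] at hn
    simpa using hn
  have hx1 : (2 : ℝ) ^ (-(κ * n)) ≤ 1 :=
    Real.rpow_le_one_of_one_le_of_nonpos one_le_two (neg_nonpos.2 (by positivity))
  have hx : (2 : ℝ) ^ (-(κ * n)) ≤ 2 ^ ((n : ℝ) * β) :=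
    Real.rpow_le_rpow_of_exponent_le one_le_two (by
      nlinarith [mul_le_mul_of_nonneg_left hκβ (Nat.cast_nonneg n : (0 : ℝ) ≤ n)])
  have hb := rpow_one_add_le_one_add_mul_self (s := -1 / 2) (by norm_num)
    (show (0 : ℝ) ≤ 2 ^ (-(κ * n)) by positivity) hx1
  have e : (1 + -1 / 2 : ℝ) ^ ((2 : ℝ) ^ (-(κ * n))) = 2 ^ (-((2 : ℝ) ^ (-(κ * n)))) := by
    rw [Real.rpow_neg zero_le_two ((2 : ℝ) ^ (-(κ * n))), ← Real.inv_rpow zero_le_two,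
      show (1 + -1 / 2 : ℝ) = 2⁻¹ by norm_num]
  rw [e] at hb
  have h1 : (2 : ℝ) ^ (-((2 : ℝ) ^ ((n : ℝ) * β))) ≤ 2 ^ (-((2 : ℝ) ^ (-(κ * n)))) :=
    Real.rpow_le_rpow_of_exponent_le one_le_two (neg_le_neg hx)
  have h2 : (2 : ℝ) ^ (-((2 : ℝ) ^ ((n : ℝ) * (1 / 4)))) < 2 ^ (-(κ * n) - 1) :=
    Real.rpow_lt_rpow_of_exponent_lt one_lt_two (by linarith)
  rw [Real.rpow_sub_one two_ne_zero] at h2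
  linarith

/-- The lower bound uses the pair (T, Z) with J = 1 - I, at rate β. The upper bound uses (Z, T) with
J = I; there any positive rate suffices, and 1/4 is taken. -/
theorem tendsto_pathProb_bhattacharyya (W : BDMC.{u}) {β : ℝ} (hβ : β < 1 / 2) :
    Tendsto (fun n : ℕ => pathProb n
      {V | V.bhattacharyya ≥ 1 - (2 : ℝ) ^ (-((2 : ℝ) ^ ((n : ℝ) * β)))} W)
      atTop (𝓝 (1 - W.symmInfo)) := by
  have hl : 0 < (Real.log 2)⁻¹ := inv_pos.2 (Real.log_pos one_lt_two)
  have hρ1 : √(15 / 16) < 1 := by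
    rw [Real.sqrt_lt' one_pos]; norm_num
  have hT : ∀ ε > 0, ∀ᶠ n : ℕ in atTop, 1 - W.symmInfo - ε
      < pathProb n {V | V.tvDist ≤ (2 : ℝ) ^ (-((2 : ℝ) ^ ((n : ℝ) * β)))} W := fun ε hε =>
    eventually_le_pathProb (X := tvDist) (Y := bhattacharyya) (J := fun V => 1 - V.symmInfo)
      (by positivity) (Real.sqrt_nonneg _) hρ1 tvDist_nonneg squaresOrDoubles_tvDist
      splitMean_sqrt_tvDist_mul_bhattacharyya_le
      (fun V => by have := splitMean_symmInfo V; unfold splitMean at this ⊢; linarith)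
      (fun V => by linarith [V.symmInfo_nonneg]) one_sub_symmInfo_le_bhattacharyya hβ W hε
  have hZ : ∀ ε > 0, ∀ᶠ n : ℕ in atTop, W.symmInfo - ε
      < pathProb n {V | V.bhattacharyya ≤ (2 : ℝ) ^ (-((2 : ℝ) ^ ((n : ℝ) * (1 / 4))))} W :=
    fun ε hε =>
    eventually_le_pathProb (X := bhattacharyya) (Y := tvDist) (J := symmInfo)
      hl.le (Real.sqrt_nonneg _) hρ1 bhattacharyya_nonneg squaresOrDoubles_bhattacharyya
      (by simpa only [mul_comm] using splitMean_sqrt_tvDist_mul_bhattacharyya_le)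
      splitMean_symmInfo symmInfo_le_one symmInfo_le_tvDist (by norm_num) W hε
  have hthr : ∀ᶠ n : ℕ in atTop, (2 : ℝ) ^ (-((2 : ℝ) ^ ((n : ℝ) * (1 / 4))))
      < 1 - (2 : ℝ) ^ (-((2 : ℝ) ^ ((n : ℝ) * β))) :=
    eventually_rpow_neg_rpow_lt_one_sub β
  rw [tendsto_order]
  constructor
  · intro a ha
    filter_upwards [hT (1 - W.symmInfo - a) (by linarith)] with n hn
    rw [sub_sub_cancel] at hn
    refine hn.trans_le (pathProb_mono n (fun V hV => ?_) W)
    have hV : V.tvDist ≤ (2 : ℝ) ^ (-((2 : ℝ) ^ ((n : ℝ) * β))) := hV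
    show 1 - (2 : ℝ) ^ (-((2 : ℝ) ^ ((n : ℝ) * β))) ≤ V.bhattacharyya
    linarith [V.one_sub_bhattacharyya_le_tvDist]
  · intro a ha
    filter_upwards [hZ (a - (1 - W.symmInfo)) (by linarith), hthr] with n hn hthr
    have h := pathProb_mono n (S := {V : BDMC.{u} | V.bhattacharyya ≥
      1 - (2 : ℝ) ^ (-((2 : ℝ) ^ ((n : ℝ) * β)))})
      (S' := {V | V.bhattacharyya ≤ (2 : ℝ) ^ (-((2 : ℝ) ^ ((n : ℝ) * (1 / 4))))}ᶜ)
      (fun V hV => not_le.2 (hthr.trans_le hV)) W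
    rw [pathProb_compl] at h
    linarith

end BDMC

/-! ### Recursion of the polar transform -/

/-- The index `2 j`. -/
def evenIdx {n : ℕ} (j : Fin (2 ^ n)) : Fin (2 ^ (n + 1)) :=
  ⟨2 * j, by have := j.2; rw [pow_succ]; omega⟩

/-- The index `2 j + 1`. -/
def oddIdx {n : ℕ} (j : Fin (2 ^ n)) : Fin (2 ^ (n + 1)) :=
  ⟨2 * j + 1, by have := j.2; rw [pow_succ]; omega⟩

/-- The index `j` in the first half. -/
def lowIdx {n : ℕ} (j : Fin (2 ^ n)) : Fin (2 ^ (n + 1)) :=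
  ⟨j, by have := j.2; rw [pow_succ]; omega⟩

/-- The index `2 ^ n + j` in the second half. -/
def highIdx {n : ℕ} (j : Fin (2 ^ n)) : Fin (2 ^ (n + 1)) :=
  ⟨2 ^ n + j, by have := j.2; rw [pow_succ]; omega⟩

theorem exists_evenIdx_or_oddIdx {n : ℕ} (k : Fin (2 ^ (n + 1))) :
    (∃ j, k = evenIdx j) ∨ ∃ j, k = oddIdx j := by
  have hk : (k : ℕ) < 2 ^ n * 2 := k.2.trans_eq (pow_succ 2 n)
  rcases Nat.even_or_odd' k with ⟨j, hj | hj⟩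
  · exact .inl ⟨⟨j, by omega⟩, Fin.ext hj⟩
  · exact .inr ⟨⟨j, by omega⟩, Fin.ext hj⟩

theorem exists_lowIdx_or_highIdx {n : ℕ} (k : Fin (2 ^ (n + 1))) :
    (∃ j, k = lowIdx j) ∨ ∃ j, k = highIdx j := by
  have hk : (k : ℕ) < 2 ^ n * 2 := k.2.trans_eq (pow_succ 2 n)
  rcases lt_or_ge (k : ℕ) (2 ^ n) with h | h
  · exact .inl ⟨⟨k, h⟩, rfl⟩
  · exact .inr ⟨⟨k - 2 ^ n, by omega⟩, Fin.ext (by simp only [highIdx]; omega)⟩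

/-- An index as a pair of its leading binary digit and its remainder. -/
def halfEquiv (n : ℕ) : Fin 2 × Fin (2 ^ n) ≃ Fin (2 ^ (n + 1)) :=
  finProdFinEquiv.trans (finCongr (pow_succ' 2 n).symm)

theorem halfEquiv_zero {n : ℕ} (j : Fin (2 ^ n)) : halfEquiv n (0, j) = lowIdx j :=
  Fin.ext (by simp [halfEquiv, lowIdx])

theorem halfEquiv_one {n : ℕ} (j : Fin (2 ^ n)) : halfEquiv n (1, j) = highIdx j :=
  Fin.ext (by simp [halfEquiv, highIdx, add_comm])

theorem sum_lowIdx_add_sum_highIdx {M : Type*} [AddCommMonoid M] {n : ℕ}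
    (f : Fin (2 ^ (n + 1)) → M) : ∑ k, f k = ∑ j, f (lowIdx j) + ∑ j, f (highIdx j) := by
  rw [← (halfEquiv n).sum_comp, Fintype.sum_prod_type, Fin.sum_univ_two]
  simp only [halfEquiv_zero, halfEquiv_one]

theorem prod_lowIdx_mul_prod_highIdx {M : Type*} [CommMonoid M] {n : ℕ}
    (f : Fin (2 ^ (n + 1)) → M) : ∏ k, f k = (∏ j, f (lowIdx j)) * ∏ j, f (highIdx j) := by
  rw [← (halfEquiv n).prod_comp, Fintype.prod_prod_type, Fin.prod_univ_two]
  simp only [halfEquiv_zero, halfEquiv_one]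

theorem sum_evenIdx_add_sum_oddIdx {M : Type*} [AddCommMonoid M] {n : ℕ}
    (f : Fin (2 ^ (n + 1)) → M) : ∑ k, f k = ∑ j, f (evenIdx j) + ∑ j, f (oddIdx j) := by
  rw [← (finProdFinEquiv.trans (finCongr (pow_succ 2 n).symm)).sum_comp, Fintype.sum_prod_type,
    ← Finset.sum_add_distrib]
  refine Finset.sum_congr rfl fun j _ => ?_
  rw [Fin.sum_univ_two]
  congr 2 <;> apply Fin.ext <;> simp [evenIdx, oddIdx]
  omega

theorem bitReversal_val (n : ℕ) (i : Fin (2 ^ n)) :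
    (bitReversal n i : ℕ) = ∑ k : Fin n, (i : ℕ) / 2 ^ (k.rev : ℕ) % 2 * 2 ^ (k : ℕ) := by
  simp only [bitReversal, Equiv.trans_apply, finFunctionFinEquiv_apply]
  refine Finset.sum_congr rfl fun k _ => ?_
  congr 1

/-- Bit reversal moves the last binary digit to the front, so parity of the input index becomes the
choice of half. This turns the block structure of the Kronecker power into an even/odd recursion on
u. -/
theorem bitReversal_evenIdx {n : ℕ} (j : Fin (2 ^ n)) :
    bitReversal (n + 1) (evenIdx j) = lowIdx (bitReversal n j) := by
  apply Fin.ext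
  simp only [lowIdx]
  rw [bitReversal_val, bitReversal_val, Fin.sum_univ_castSucc]
  simp [evenIdx, Fin.rev_castSucc, pow_succ', ← Nat.div_div_eq_div_mul]

theorem bitReversal_oddIdx {n : ℕ} (j : Fin (2 ^ n)) :
    bitReversal (n + 1) (oddIdx j) = highIdx (bitReversal n j) := by
  apply Fin.ext
  simp only [highIdx]
  rw [bitReversal_val, bitReversal_val, Fin.sum_univ_castSucc, add_comm]
  have h : (2 * (j : ℕ) + 1) / 2 = j := by omega
  have h' : (2 * (j : ℕ) + 1) % 2 = 1 := by omega
  simp [oddIdx, Fin.rev_castSucc, pow_succ', ← Nat.div_div_eq_div_mul, h, h']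

theorem bitReversal_symm_lowIdx {n : ℕ} (j : Fin (2 ^ n)) :
    (bitReversal (n + 1)).symm (lowIdx j) = evenIdx ((bitReversal n).symm j) := by
  rw [Equiv.symm_apply_eq, bitReversal_evenIdx, Equiv.apply_symm_apply]

theorem bitReversal_symm_highIdx {n : ℕ} (j : Fin (2 ^ n)) :
    (bitReversal (n + 1)).symm (highIdx j) = oddIdx ((bitReversal n).symm j) := by
  rw [Equiv.symm_apply_eq, bitReversal_oddIdx, Equiv.apply_symm_apply]

theorem polarKroneckerPow_succ_halfEquiv (n : ℕ) (a b : Fin 2) (i j : Fin (2 ^ n)) :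
    polarKroneckerPow (n + 1) (halfEquiv n (a, i)) (halfEquiv n (b, j))
      = polarKernel a b * polarKroneckerPow n i j := by
  simp only [polarKroneckerPow]
  change Matrix.reindex (halfEquiv n) (halfEquiv n) _ _ _ = _
  simp [Matrix.kroneckerMap_apply]

theorem vecMul_polarTransform (n : ℕ) (u : Fin (2 ^ n) → ZMod 2) :
    Matrix.vecMul u (polarTransform n)
      = Matrix.vecMul (u ∘ (bitReversal n).symm) (polarKroneckerPow n) := by
  rw [polarTransform, ← Matrix.vecMul_vecMul, Matrix.vecMul_permMatrix]

theorem vecMul_polarTransform_lowIdx {n : ℕ} (u : Fin (2 ^ (n + 1)) → ZMod 2) (j : Fin (2 ^ n)) :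
    Matrix.vecMul u (polarTransform (n + 1)) (lowIdx j)
      = Matrix.vecMul (fun k => u (evenIdx k) + u (oddIdx k)) (polarTransform n) j := by
  rw [vecMul_polarTransform, vecMul_polarTransform]
  simp only [Matrix.vecMul, dotProduct]
  rw [sum_lowIdx_add_sum_highIdx, ← Finset.sum_add_distrib]
  refine Finset.sum_congr rfl fun k _ => ?_
  simp only [Function.comp_apply, bitReversal_symm_lowIdx, bitReversal_symm_highIdx]
  rw [← halfEquiv_zero, ← halfEquiv_zero, ← halfEquiv_one, polarKroneckerPow_succ_halfEquiv,
    polarKroneckerPow_succ_halfEquiv]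
  simp [polarKernel]
  ring

theorem vecMul_polarTransform_highIdx {n : ℕ} (u : Fin (2 ^ (n + 1)) → ZMod 2)
    (j : Fin (2 ^ n)) :
    Matrix.vecMul u (polarTransform (n + 1)) (highIdx j)
      = Matrix.vecMul (fun k => u (oddIdx k)) (polarTransform n) j := by
  rw [vecMul_polarTransform, vecMul_polarTransform]
  simp only [Matrix.vecMul, dotProduct]
  rw [sum_lowIdx_add_sum_highIdx, ← Finset.sum_add_distrib]
  refine Finset.sum_congr rfl fun k _ => ?_
  simp only [Function.comp_apply, bitReversal_symm_lowIdx, bitReversal_symm_highIdx]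
  rw [← halfEquiv_zero, ← halfEquiv_one, ← halfEquiv_one, polarKroneckerPow_succ_halfEquiv,
    polarKroneckerPow_succ_halfEquiv]
  simp [polarKernel]

/-- The two half-length inputs `(u_even ⊕ u_odd, u_odd)` of the polar transform recursion. -/
def splitInput {n : ℕ} (u : Fin (2 ^ (n + 1)) → ZMod 2) :
    (Fin (2 ^ n) → ZMod 2) × (Fin (2 ^ n) → ZMod 2) :=
  (fun k => u (evenIdx k) + u (oddIdx k), fun k => u (oddIdx k))

theorem splitInput_bijective (n : ℕ) : Function.Bijective (splitInput (n := n)) := by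
  rw [Fintype.bijective_iff_injective_and_card]
  constructor
  · intro u u' h
    have h1 : ∀ k, u (evenIdx k) + u (oddIdx k) = u' (evenIdx k) + u' (oddIdx k) :=
      congrFun (congrArg Prod.fst h)
    have h2 : ∀ k, u (oddIdx k) = u' (oddIdx k) := congrFun (congrArg Prod.snd h)
    ext1 k
    rcases exists_evenIdx_or_oddIdx k with ⟨j, rfl⟩ | ⟨j, rfl⟩
    · have := h1 j
      rwa [h2 j, add_left_inj] at this
    · exact h2 j
  · simp [ZMod.card, pow_succ, pow_mul]

namespace BDMC

theorem blockProb_succ (W : BDMC.{u}) {n : ℕ} (u : Fin (2 ^ (n + 1)) → ZMod 2)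
    (y : Fin (2 ^ (n + 1)) → W.Out) :
    W.blockProb (n + 1) u y = W.blockProb n (splitInput u).1 (fun j => y (lowIdx j))
      * W.blockProb n (splitInput u).2 (fun j => y (highIdx j)) := by
  simp only [blockProb, splitInput]
  rw [prod_lowIdx_mul_prod_highIdx]
  simp only [vecMul_polarTransform_lowIdx, vecMul_polarTransform_highIdx]

/-! ### Synthetic channels as iterated splits -/

/-- Two channels agree up to a relabelling of the output alphabet. -/
def Relabel (V V' : BDMC.{u}) : Prop :=
  ∃ e : V.Out → V'.Out, Function.Bijective e ∧ ∀ x y, V'.prob x (e y) = V.prob x y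

theorem Relabel.bhattacharyya_eq {V V' : BDMC.{u}} (h : Relabel V V') :
    V.bhattacharyya = V'.bhattacharyya := by
  obtain ⟨e, he, h⟩ := h
  simp only [bhattacharyya]
  rw [← he.sum_comp]
  simp only [h]

theorem Relabel.minus {V V' : BDMC.{u}} (h : Relabel V V') : Relabel V.minus V'.minus := by
  obtain ⟨e, he, h⟩ := h
  refine ⟨Prod.map e e, he.prodMap he, fun x y => ?_⟩
  obtain ⟨a, b⟩ : V.Out × V.Out := y
  simp only [BDMC.minus, Prod.map_apply, h]

theorem Relabel.plus {V V' : BDMC.{u}} (h : Relabel V V') : Relabel V.plus V'.plus := by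
  obtain ⟨e, he, h⟩ := h
  refine ⟨Prod.map e (Prod.map e id), he.prodMap (he.prodMap Function.bijective_id),
    fun x y => ?_⟩
  obtain ⟨a, b, c⟩ : V.Out × V.Out × ZMod 2 := y
  simp only [BDMC.plus, Prod.map_apply, h, id]

theorem relabel_synth_zero (W : BDMC.{u}) (i : Fin (2 ^ 0)) : Relabel (W.synth 0 i) W := by
  obtain rfl : i = 0 := Subsingleton.elim (α := Fin 1) i 0
  refine ⟨fun o : (Fin 1 → W.Out) × (Fin 0 → ZMod 2) => o.1 0, ⟨?_, fun y => ?_⟩, fun x o => ?_⟩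
  · rintro ⟨y, p⟩ ⟨y', p'⟩ h
    refine Prod.ext (funext fun j => ?_) (funext fun j => j.elim0)
    obtain rfl : j = 0 := Subsingleton.elim (α := Fin 1) j 0
    exact h
  · exact ⟨(fun _ => y, fun j => j.elim0), rfl⟩
  · obtain ⟨y, p⟩ : (Fin 1 → W.Out) × (Fin 0 → ZMod 2) := o
    have hu : ∀ u : Fin 1 → ZMod 2, u = fun _ => u 0 := fun u =>
      funext fun j => congrArg u (Subsingleton.elim j 0)
    simp only [synth]
    rw [Finset.sum_eq_single_of_mem (fun _ => x)]
    · have h : Matrix.vecMul (fun _ => x) (polarTransform 0) = fun _ => x := by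
        rw [vecMul_polarTransform, polarKroneckerPow, Matrix.vecMul_one]
        rfl
      simp only [blockProb, h]
      simp
    · rw [Finset.mem_filter]
      exact ⟨Finset.mem_univ _, rfl, fun j => j.elim0⟩
    · intro u hux hne
      rw [Finset.mem_filter] at hux
      obtain ⟨-, rfl, -⟩ := hux
      exact (hne (hu u)).elim

theorem one_div_two_pow_succ_sub_one (n : ℕ) : (1 / 2 ^ (2 ^ (n + 1) - 1) : ℝ)
    = 1 / 2 * (1 / 2 ^ (2 ^ n - 1) * (1 / 2 ^ (2 ^ n - 1))) := by
  have h : 2 ^ (n + 1) - 1 = 1 + ((2 ^ n - 1) + (2 ^ n - 1)) := by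
    have := Nat.one_le_two_pow (n := n)
    rw [pow_succ]; omega
  rw [h, pow_add, pow_add, pow_one, one_div_mul_one_div, one_div_mul_one_div]

theorem sum_filter_mul_sum_filter {α β : Type*} [Fintype α] [Fintype β] (A : α → Prop)
    (B : β → Prop) [DecidablePred A] [DecidablePred B] (F : α → ℝ) (G : β → ℝ) :
    (∑ s with A s, F s) * ∑ t with B t, G t
      = ∑ st : α × β, if A st.1 ∧ B st.2 then F st.1 * G st.2 else 0 := by
  rw [Finset.sum_filter, Finset.sum_filter, Finset.sum_mul_sum, Fintype.sum_prod_type]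
  refine Finset.sum_congr rfl fun s _ => Finset.sum_congr rfl fun t _ => ?_
  split_ifs <;> simp_all

/-- The output relabelling from `W^(2i)` to the `[0]`-split of `W^(i)`. -/
def evenRelabel (W : BDMC.{u}) {n : ℕ} (i : Fin (2 ^ n))
    (o : (Fin (2 ^ (n + 1)) → W.Out) × (Fin (2 * i) → ZMod 2)) :
    ((Fin (2 ^ n) → W.Out) × (Fin i → ZMod 2)) × ((Fin (2 ^ n) → W.Out) × (Fin i → ZMod 2)) :=
  ((fun j => o.1 (lowIdx j), fun j => o.2 ⟨2 * j, by omega⟩ + o.2 ⟨2 * j + 1, by omega⟩),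
    (fun j => o.1 (highIdx j), fun j => o.2 ⟨2 * j + 1, by omega⟩))

theorem evenRelabel_bijective (W : BDMC.{u}) {n : ℕ} (i : Fin (2 ^ n)) :
    Function.Bijective (W.evenRelabel i) := by
  classical
  rw [Fintype.bijective_iff_injective_and_card]
  constructor
  · rintro ⟨y, p⟩ ⟨y', p'⟩ h
    simp only [evenRelabel, Prod.mk.injEq, funext_iff] at h
    obtain ⟨⟨h1, h2⟩, h3, h4⟩ := h
    refine Prod.ext (funext fun k => ?_) (funext fun k => ?_)
    · rcases exists_lowIdx_or_highIdx k with ⟨j, rfl⟩ | ⟨j, rfl⟩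
      exacts [h1 j, h3 j]
    · rcases Nat.even_or_odd' k with ⟨j, hj | hj⟩
      · have a := h2 ⟨j, by omega⟩
        rw [h4, add_left_inj] at a
        rwa [show k = ⟨2 * j, by omega⟩ from Fin.ext hj]
      · have a := h4 ⟨j, by omega⟩
        rwa [show k = ⟨2 * j + 1, by omega⟩ from Fin.ext hj]
  · simp only [Fintype.card_prod, Fintype.card_pi, Finset.prod_const, Finset.card_univ,
      Fintype.card_fin, ZMod.card]
    ring

/-- The output relabelling from `W^(2i+1)` to the `[1]`-split of `W^(i)`. -/
def oddRelabel (W : BDMC.{u}) {n : ℕ} (i : Fin (2 ^ n))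
    (o : (Fin (2 ^ (n + 1)) → W.Out) × (Fin (2 * i + 1) → ZMod 2)) :
    ((Fin (2 ^ n) → W.Out) × (Fin i → ZMod 2)) ×
      ((Fin (2 ^ n) → W.Out) × (Fin i → ZMod 2)) × ZMod 2 :=
  ((fun j => o.1 (lowIdx j), fun j => o.2 ⟨2 * j, by omega⟩ + o.2 ⟨2 * j + 1, by omega⟩),
    (fun j => o.1 (highIdx j), fun j => o.2 ⟨2 * j + 1, by omega⟩), o.2 ⟨2 * i, by omega⟩)

theorem oddRelabel_bijective (W : BDMC.{u}) {n : ℕ} (i : Fin (2 ^ n)) :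
    Function.Bijective (W.oddRelabel i) := by
  classical
  rw [Fintype.bijective_iff_injective_and_card]
  constructor
  · rintro ⟨y, p⟩ ⟨y', p'⟩ h
    simp only [oddRelabel, Prod.mk.injEq, funext_iff] at h
    obtain ⟨⟨h1, h2⟩, ⟨h3, h4⟩, h5⟩ := h
    refine Prod.ext (funext fun k => ?_) (funext fun k => ?_)
    · rcases exists_lowIdx_or_highIdx k with ⟨j, rfl⟩ | ⟨j, rfl⟩
      exacts [h1 j, h3 j]
    · rcases Nat.even_or_odd' k with ⟨j, hj | hj⟩
      · rcases eq_or_ne j i with rfl | hji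
        · rwa [show k = ⟨2 * i, by omega⟩ from Fin.ext hj]
        · have a := h2 ⟨j, by omega⟩
          rw [h4, add_left_inj] at a
          rwa [show k = ⟨2 * j, by omega⟩ from Fin.ext hj]
      · have a := h4 ⟨j, by omega⟩
        rwa [show k = ⟨2 * j + 1, by omega⟩ from Fin.ext hj]
  · simp only [Fintype.card_prod, Fintype.card_pi, Finset.prod_const, Finset.card_univ,
      Fintype.card_fin, ZMod.card]
    ring

/-- Knowing the first i entries of both half-length inputs amounts to knowing the first 2i entries
of u. The length m is left free because it is 2i for the minus split and 2i + 1 for the plus split.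
-/
theorem splitInput_prefix_iff {n : ℕ} {i : Fin (2 ^ n)} {m : ℕ} (hm : 2 * (i : ℕ) ≤ m)
    (hm' : m ≤ 2 ^ (n + 1)) (u : Fin (2 ^ (n + 1)) → ZMod 2) (p : Fin m → ZMod 2) :
    ((∀ j : Fin i, (splitInput u).1 (Fin.castLE i.isLt.le j)
        = p ⟨2 * j, by omega⟩ + p ⟨2 * j + 1, by omega⟩) ∧
      ∀ j : Fin i, (splitInput u).2 (Fin.castLE i.isLt.le j) = p ⟨2 * j + 1, by omega⟩) ↔
    ∀ k : Fin m, (k : ℕ) < 2 * i → u (Fin.castLE hm' k) = p k := by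
  constructor
  · rintro ⟨h1, h2⟩ k hk
    rcases Nat.even_or_odd' k with ⟨j, hj | hj⟩
    · have a := h1 ⟨j, by omega⟩
      have b := h2 ⟨j, by omega⟩
      simp only [splitInput] at a b
      rw [b, add_left_inj] at a
      convert a using 2 <;> apply Fin.ext <;> simp [evenIdx, hj]
    · have b := h2 ⟨j, by omega⟩
      simp only [splitInput] at b
      convert b using 2 <;> apply Fin.ext <;> simp [oddIdx, hj]
  · intro h
    have h2 : ∀ j : Fin i, (splitInput u).2 (Fin.castLE i.isLt.le j)
        = p ⟨2 * j + 1, by omega⟩ := fun j => h ⟨2 * j + 1, by omega⟩ (by simp only; omega)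
    refine ⟨fun j => ?_, h2⟩
    have a := h ⟨2 * j, by omega⟩ (by simp only; omega)
    have b := h2 j
    simp only [splitInput] at b ⊢
    rw [b, ← a]
    rfl

theorem ite_eq_ite_of_iff {α : Type*} {b c : Prop} {_ : Decidable b} {_ : Decidable c}
    (h : b ↔ c) (x y : α) : ite b x y = ite c x y :=
  if_congr h rfl rfl

theorem relabel_synth_evenIdx (W : BDMC.{u}) {n : ℕ} (i : Fin (2 ^ n)) :
    Relabel (W.synth (n + 1) (evenIdx i)) (W.synth n i).minus := by
  refine ⟨W.evenRelabel i, W.evenRelabel_bijective i, fun x o => ?_⟩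
  obtain ⟨y, p⟩ : (Fin (2 ^ (n + 1)) → W.Out) × (Fin (2 * i) → ZMod 2) := o
  simp only [minus, synth, evenRelabel]
  rw [one_div_two_pow_succ_sub_one, mul_assoc (1 / 2 : ℝ)]
  congr 1
  simp only [mul_mul_mul_comm, ← Finset.mul_sum]
  congr 1
  simp only [sum_filter_mul_sum_filter]
  rw [Finset.sum_comm, ← (splitInput_bijective n).sum_comp, Finset.sum_filter]
  refine Finset.sum_congr rfl fun u _ => ?_
  have hpre := splitInput_prefix_iff (m := 2 * i) le_rfl (evenIdx i).isLt.le u p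
  -- The bit u₁ averaged out by the minus split is the entry of index 2i + 1 of u, which is among
  -- the completions summed over, so each u selects exactly one u₁.
  rw [Finset.sum_eq_single ((splitInput u).2 i), W.blockProb_succ]
  · refine ite_eq_ite_of_iff ?_ _ _
    constructor
    · rintro ⟨⟨h1, h2⟩, -, h3⟩
      exact ⟨add_right_cancel h1, fun k => hpre.1 ⟨h2, h3⟩ k k.2⟩
    · rintro ⟨h1, h2⟩
      have h := hpre.2 fun k _ => h2 k
      exact ⟨⟨congrArg (· + u (oddIdx i)) h1, h.1⟩, rfl, h.2⟩
  · intro v _ hv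
    exact if_neg fun h => hv h.2.1.symm
  · simp

theorem relabel_synth_oddIdx (W : BDMC.{u}) {n : ℕ} (i : Fin (2 ^ n)) :
    Relabel (W.synth (n + 1) (oddIdx i)) (W.synth n i).plus := by
  refine ⟨W.oddRelabel i, W.oddRelabel_bijective i, fun x o => ?_⟩
  obtain ⟨y, p⟩ : (Fin (2 ^ (n + 1)) → W.Out) × (Fin (2 * i + 1) → ZMod 2) := o
  simp only [plus, synth, oddRelabel]
  rw [one_div_two_pow_succ_sub_one, mul_assoc (1 / 2 : ℝ), mul_mul_mul_comm]
  congr 2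
  rw [sum_filter_mul_sum_filter, ← (splitInput_bijective n).sum_comp, Finset.sum_filter]
  refine Finset.sum_congr rfl fun u _ => ?_
  have hpre := splitInput_prefix_iff (m := 2 * i + 1) (Nat.le_succ _) (oddIdx i).isLt.le u p
  rw [W.blockProb_succ]
  refine ite_eq_ite_of_iff ?_ _ _
  constructor
  · rintro ⟨⟨h1, h2⟩, h3, h4⟩
    refine ⟨h3, fun k => ?_⟩
    rcases (Nat.lt_succ_iff.1 k.2).lt_or_eq with hk | hk
    · exact hpre.1 ⟨h2, h4⟩ k hk
    -- The last known entry, of index 2i, is the bit u₀ that the plus split adds to its output.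
    · obtain rfl : k = ⟨2 * i, Nat.lt_succ_self _⟩ := Fin.ext hk
      rw [← h3] at h1
      exact add_right_cancel h1
  · rintro ⟨h1, h2⟩
    have h := hpre.2 fun k _ => h2 k
    have h0 : u (evenIdx i) = p ⟨2 * i, Nat.lt_succ_self _⟩ := h2 ⟨2 * i, Nat.lt_succ_self _⟩
    refine ⟨⟨?_, h.1⟩, h1, h.2⟩
    simp only [splitInput]
    rw [h0, h1]

/-- The last binary digit of the index selects the last split. Invariance of f under relabelling is
needed because the output alphabets agree only up to bijection. -/
theorem sum_synth_eq_pathMean (W : BDMC.{u}) (n : ℕ) {f : BDMC.{u} → ℝ}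
    (hf : ∀ {V V'}, Relabel V V' → f V = f V') :
    (∑ i, f (W.synth n i)) / 2 ^ n = pathMean n f W := by
  induction n generalizing f with
  | zero =>
    rw [Fintype.sum_eq_single (0 : Fin (2 ^ 0))
      (fun i hi => (hi (Subsingleton.elim (α := Fin 1) i 0)).elim)]
    simp [hf (W.relabel_synth_zero 0)]
  | succ n ih =>
    rw [pathMean_succ, ← ih (f := splitMean f)
      (fun h => by rw [splitMean, splitMean, hf h.minus, hf h.plus]), sum_evenIdx_add_sum_oddIdx]
    simp only [splitMean, hf (W.relabel_synth_evenIdx _), hf (W.relabel_synth_oddIdx _)]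
    rw [← Finset.sum_div, Finset.sum_add_distrib, pow_succ, div_div, mul_comm (2 : ℝ)]

/-! ### Random bits and counting as path averages -/

theorem tree_congr (W : BDMC.{u}) {b b' : ℕ → Fin 2} {n : ℕ} (h : ∀ k < n, b k = b' k) :
    W.tree b n = W.tree b' n := by
  induction n with
  | zero => rfl
  | succ n ih =>
    rw [tree, tree, ih fun k hk => h k (hk.trans n.lt_succ_self), h n n.lt_succ_self]

/-- The channel reached from `W` along a finite sequence of bits. -/
noncomputable def descend (W : BDMC.{u}) {n : ℕ} (c : Fin n → Fin 2) : BDMC.{u} :=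
  -- The padding value 0 is never read: depth n depends only on the first n bits, by `tree_congr`.
  W.tree (fun k => if h : k < n then c ⟨k, h⟩ else 0) n

theorem tree_eq_descend (W : BDMC.{u}) (b : ℕ → Fin 2) (n : ℕ) :
    W.tree b n = W.descend fun k : Fin n => b k :=
  W.tree_congr fun k hk => by rw [dif_pos hk]

theorem descend_snoc (W : BDMC.{u}) {n : ℕ} (c : Fin n → Fin 2) (a : Fin 2) :
    W.descend (Fin.snoc c a : Fin (n + 1) → Fin 2) = (W.descend c).split a := by
  simp only [descend, tree]
  congr 1
  · refine W.tree_congr fun k hk => ?_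
    rw [dif_pos hk, dif_pos (hk.trans n.lt_succ_self)]
    exact Fin.snoc_castSucc (α := fun _ => Fin 2) a c ⟨k, hk⟩
  · rw [dif_pos n.lt_succ_self]
    exact Fin.snoc_last (α := fun _ => Fin 2) a c

theorem sum_descend_eq_pathMean (W : BDMC.{u}) (n : ℕ) (f : BDMC.{u} → ℝ) :
    (∑ c : Fin n → Fin 2, f (W.descend c)) / 2 ^ n = pathMean n f W := by
  induction n generalizing f with
  | zero => simp [descend, tree]
  | succ n ih =>
    rw [pathMean_succ, ← ih, ← (Fin.snocEquiv fun _ => Fin 2).sum_comp, Fintype.sum_prod_type_right]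
    have h : ∀ c : Fin n → Fin 2, ∑ a : Fin 2, f (W.descend (Fin.snoc c a : Fin (n + 1) → Fin 2))
        = 2 * splitMean f (W.descend c) := by
      intro c
      rw [Fin.sum_univ_two, descend_snoc, descend_snoc, splitMean]
      simp only [split]
      norm_num
      ring
    rw [pow_succ, mul_comm, ← div_div]
    congr 1
    refine (congrArg (· / 2) (Finset.sum_congr rfl fun c _ => h c)).trans ?_
    simp only [← Finset.mul_sum]
    ring

theorem measureReal_eq_of_fair_bits {Ω : Type v} [MeasurableSpace Ω] (μ : Measure Ω)
    [IsProbabilityMeasure μ] (B : ℕ → Ω → Fin 2) (hind : iIndepFun B μ)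
    (h0 : ∀ n, μ {ω | B n ω = 0} = 1 / 2) (h1 : ∀ n, μ {ω | B n ω = 1} = 1 / 2)
    (n : ℕ) (c : Fin n → Fin 2) : μ.real {ω | (fun k : Fin n => B k ω) = c} = 1 / 2 ^ n := by
  have hb : ∀ (k : ℕ) (a : Fin 2), μ (B k ⁻¹' {a}) = 1 / 2 := by
    intro k a
    fin_cases a
    exacts [h0 k, h1 k]
  have h := hind.measure_inter_preimage_eq_mul (Finset.range n)
    (sets := fun k => if h : k < n then {c ⟨k, h⟩} else ∅) (fun k _ => MeasurableSet.of_discrete)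
  have hset : (⋂ k ∈ Finset.range n, B k ⁻¹' (if h : k < n then {c ⟨k, h⟩} else ∅))
      = {ω | (fun k : Fin n => B k ω) = c} := by
    ext ω
    simp only [Set.mem_iInter, Finset.mem_range, Set.mem_preimage]
    constructor
    · intro hω
      refine funext fun k => ?_
      have := hω k k.2
      rwa [dif_pos k.2] at this
    · intro hω k hk
      rw [dif_pos hk]
      exact congrFun hω ⟨k, hk⟩
  have hprod : ∏ k ∈ Finset.range n, μ (B k ⁻¹' (if h : k < n then {c ⟨k, h⟩} else ∅))
      = (1 / 2) ^ n := by
    rw [Finset.prod_congr rfl (g := fun _ => 1 / 2), Finset.prod_const, Finset.card_range]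
    intro k hk
    rw [dif_pos (Finset.mem_range.1 hk), hb]
  rw [hset, hprod] at h
  rw [measureReal_def, h, one_div, ENNReal.toReal_pow, ENNReal.toReal_inv]
  simp

/-- The event depends only on the first n bits, so it is a finite disjoint union of cylinders of
mass 2^(-n). No measurability of S is involved. -/
theorem measureReal_tree_eq_pathProb (W : BDMC.{u}) {Ω : Type v} [MeasurableSpace Ω]
    (μ : Measure Ω) [IsProbabilityMeasure μ] (B : ℕ → Ω → Fin 2) (hB : ∀ n, Measurable (B n))
    (hind : iIndepFun B μ) (h0 : ∀ n, μ {ω | B n ω = 0} = 1 / 2)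
    (h1 : ∀ n, μ {ω | B n ω = 1} = 1 / 2) (n : ℕ) (S : Set BDMC.{u}) :
    μ.real {ω | W.tree (fun k => B k ω) n ∈ S} = pathProb n S W := by
  classical
  have hg : Measurable fun ω => fun k : Fin n => B k ω := measurable_pi_lambda _ fun k => hB k
  have hset : {ω | W.tree (fun k => B k ω) n ∈ S} = (fun ω => fun k : Fin n => B k ω) ⁻¹'
      ↑(Finset.univ.filter fun c : Fin n → Fin 2 => W.descend c ∈ S) := by
    ext ω
    simp [tree_eq_descend]
  have := Measure.isProbabilityMeasure_map (μ := μ) hg.aemeasurable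
  rw [hset, ← map_measureReal_apply hg (Finset.measurableSet _), ← sum_measureReal_singleton,
    pathProb, ← sum_descend_eq_pathMean, Finset.sum_filter, Finset.sum_div]
  refine Finset.sum_congr rfl fun c _ => ?_
  rw [map_measureReal_apply hg (measurableSet_singleton c)]
  have h := measureReal_eq_of_fair_bits μ B hind h0 h1 n c
  by_cases hc : W.descend c ∈ S
  · rw [if_pos hc, Set.indicator_of_mem hc, Pi.one_apply]
    exact h
  · rw [if_neg hc, Set.indicator_of_notMem hc, zero_div]

theorem ncard_synth_eq_pathProb (W : BDMC.{u}) (n : ℕ) (θ : ℝ) :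
    ({i : Fin (2 ^ n) | (W.synth n i).bhattacharyya ≥ θ}.ncard : ℝ) / 2 ^ n
      = pathProb n {V | V.bhattacharyya ≥ θ} W := by
  classical
  rw [pathProb, ← sum_synth_eq_pathMean W n (f := Set.indicator {V | V.bhattacharyya ≥ θ} 1)
    (fun h => by simp only [Set.indicator, Set.mem_ofPred_eq, h.bhattacharyya_eq]; rfl)]
  congr 1
  rw [Set.ncard_eq_toFinset_card', Finset.card_eq_sum_ones, Nat.cast_sum, Set.toFinset_ofPred,
    Finset.sum_filter]
  simp [Set.indicator]

end BDMC

theorem mainTheorem2 (W : BDMC.{u}) (β : ℝ) (hβ : β < 1 / 2) :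
    (∀ {Ω : Type v} [MeasurableSpace Ω] (μ : Measure Ω) [IsProbabilityMeasure μ]
      (B : ℕ → Ω → Fin 2), (∀ n, Measurable (B n)) → iIndepFun B μ →
      (∀ n, μ {ω | B n ω = 0} = 1 / 2) → (∀ n, μ {ω | B n ω = 1} = 1 / 2) →
      Tendsto
        (fun n : ℕ => μ.real {ω | (W.tree (fun k => B k ω) n).bhattacharyya
          ≥ 1 - (2 : ℝ) ^ (-((2 : ℝ) ^ ((n : ℝ) * β)))})
        atTop (𝓝 (1 - W.symmInfo))) ∧
    Tendsto
      (fun n : ℕ => ({i : Fin (2 ^ n) | (W.synth n i).bhattacharyya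
          ≥ 1 - (2 : ℝ) ^ (-((2 : ℝ) ^ ((n : ℝ) * β)))}.ncard : ℝ) / 2 ^ n)
      atTop (𝓝 (1 - W.symmInfo)) := by
  have h := W.tendsto_pathProb_bhattacharyya hβ
  constructor
  · intro Ω _ μ _ B hB hind h0 h1
    refine h.congr fun n => ?_
    exact (W.measureReal_tree_eq_pathProb μ B hB hind h0 h1 n _).symm
  · exact h.congr fun n => (W.ncard_synth_eq_pathProb n _).symm
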